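/- **Setting.** Let $a(k)\in\mathbb C$, $k\ge 0$, satisfy $\sum_k|a(k)|<\infty$ and $\sum_k (k+1)|a(k)|^2<\infty$, and put $A(e^{i\lambda})=\sum_{k\ge 0}a(k)e^{-i\lambda k}$. A spectral density is a nonnegative integrable function on $(-\pi,\pi]$. Let $\xi,\eta$ be uncorrelated stationary sequences with spectral densities $f,g$; the functional $A\xi=\sum_{k\ge0}a(k)\xi(-k)$ is estimated from the observations $\xi(m)+\eta(m)$, $m\le 0$. Let $L_2^0(w)$ be the closed span of $\{e^{im\lambda}:m\le 0\}$ in $L_2(w\,d\lambda)$. The estimate with spectral characteristic $h\in L_2^0(f+g)$ has mean-square error $$\Delta(h;f,g)=\frac1{2\pi}\int_{-\pi}^{\pi}|A(e^{i\lambda})-h(\lambda)|^2f(\lambda)\,d\lambda+\frac1{2\pi}\int_{-\pi}^{\pi}|h(\lambda)|^2g(\lambda)\,d\lambda ,$$ and the optimal spectral characteristic $h(f,g)$ minimizes $\Delta(\cdot\,;f,g)$ over $L_2^0(f+g)$. For a class $\mathcal D$ of pairs of spectral densities, $(f^0,g^0)\in\mathcal D$ is *least favorable* if $\Delta(h(f^0,g^0);f^0,g^0)=\max_{(f,g)\in\mathcal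 D}\Delta(h(f,g);f,g)$. A function $h^0$ is *minimax-robust* if $h^0\in H_{\mathcal D}=\bigcap_{(f,g)\in\mathcal D}L_2^0(f+g)$ and $\min_{h\in H_{\mathcal D}}\sup_{(f,g)\in\mathcal D}\Delta(h;f,g)=\sup_{(f,g)\in\mathcal D}\Delta(h^0;f,g)$. If the minimality condition $\int_{-\pi}^{\pi}\frac{d\lambda}{f+g}<\infty$ holds, define matrices, for $l,k,m\ge 0$, $$P_{l,k}=\frac1{2\pi}\int_{-\pi}^{\pi}\frac{e^{i\lambda(k-l)}}{f+g}d\lambda,\quad (R)_{l,m}=\frac1{2\pi}\int_{-\pi}^{\pi}e^{-i\lambda(l+1+m)}\frac{f}{f+g}d\lambda,\quad Q_{l,k}=\frac1{2\pi}\int_{-\pi}^{\pi}e^{i\lambda(l-k)}\frac{fg}{f+g}d\lambda .$$ The operator $P$ is positive but may be unbounded, and $P^{-1}$ is understood in the energy sense: if finitely supported vectors $x_n$ satisfy $\langle P(x_n-x_m),x_n-x_m\rangle\to0$ as $n,m\to\infty$ and $(Px_n)_l\to(Ra)_l$ for all $l$, then $(P^{-1}Ra)_k=\lim_n (x_n)_k$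 and $\langle Ra,P^{-1}Ra\rangle=\lim_n\langle Ra,x_n\rangle$ (for bounded $P$ and $c\in\ell_2$ with $Pc=Ra$ this gives $P^{-1}Ra=c$). The sum $\sum_k c_ke^{i\lambda(k+1)}$ denotes the integrable function with this Fourier series. For a real number $P_2$ let $\mathcal D_g=\{g \text{ a spectral density}:\frac1{2\pi}\int_{-\pi}^{\pi} g\,d\lambda\le P_2\}$. **Theorem.** Let the spectral density $f$ be known, i.e. $\mathcal D=\{f\}\times\mathcal D_g$. Let $g^0\in\mathcal D_g$ be such that $(f,g^0)$ satisfies the minimality condition, let $P^0,R^0$ be the matrices of the pair $(f,g^0)$, and put $C^0(\lambda)=\sum_{k\ge0}((P^0)^{-1}R^0a)_k\,e^{i\lambda(k+1)}$. Suppose that 1. the function $h_g(f,g^0)=\dfrac{|A(e^{i\lambda})f(\lambda)-C^0(\lambda)|}{f(\lambda)+g^0(\lambda)}$ is (essentially) bounded; 2. for some constant $\alpha_2>0$, for almost every $\lambda$, $$g^0(\lambda)=\max\Big\{0,\ \frac{|A(e^{i\lambda})f(\lambda)-C^0(\lambda)|}{\alpha_2}-f(\lambda)\Big\};$$ 3.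 $(f,g^0)$ solves the optimization problem of maximizing $\langle Ra,P^{-1}Ra\rangle+\langle Qa,a\rangle$ over the pairs $(f,g)\in\mathcal D$ that satisfy the minimality condition. Then $(f,g^0)$ is least favorable in $\mathcal D$ (that is, $g^0$ is least favorable in $\mathcal D_g$), and $$h(f,g^0)(\lambda)=\frac{A(e^{i\lambda})f(\lambda)-C^0(\lambda)}{f(\lambda)+g^0(\lambda)}$$ is the optimal spectral characteristic for $(f,g^0)$ and is minimax-robust for $\mathcal D$. -/

import Mathlib

open MeasureTheory Filter Topology
open scoped ComplexConjugate ENNReal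

noncomputable section

namespace Filtering

/-- The normalized Lebesgue measure `dλ / 2π` on `(-π, π]`. -/
def arc : Measure ℝ :=
  ENNReal.ofReal (1 / (2 * Real.pi)) • volume.restrict (Set.Ioc (-Real.pi) Real.pi)

/-- The exponential `e^{imλ}`. -/
def expo (m : ℤ) (t : ℝ) : ℂ := Complex.exp (Complex.I * m * t)

/-- Spectral densities: nonnegative integrable functions on `(-π, π]`. -/
def IsSpectralDensity (f : ℝ → ℝ) : Prop :=
  Integrable f arc ∧ ∀ᵐ t ∂arc, 0 ≤ f t

/-- The minimality condition `∫ 1 / (f + g) dλ < ∞`, where `1 / 0 = ∞`. -/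
def Minimality (f g : ℝ → ℝ) : Prop :=
  ∫⁻ t, (ENNReal.ofReal (f t + g t))⁻¹ ∂arc < ⊤

/-- The function `A(e^{iλ}) = ∑ a(k) e^{-iλk}` of the functional `Aξ = ∑ a(k) ξ(-k)`. -/
def transfer (a : ℕ → ℂ) (t : ℝ) : ℂ := ∑' k : ℕ, a k * expo (-(k : ℤ)) t

/-! ### Estimates, their errors, and the minimax notions -/

/-- `h` belongs to `L₂⁰(w)`, the closed span of `e^{imλ}`, `m ≤ 0`, in `L₂(w)`. The finitely
supported `p` lists the coefficients of a polynomial in `e^{-iλ}`. -/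
def MemPastL2 (w : ℝ → ℝ) (h : ℝ → ℂ) : Prop :=
  MemLp h 2 (arc.withDensity fun t => ENNReal.ofReal (w t)) ∧
  ∀ ε : ℝ≥0∞, 0 < ε → ∃ p : ℕ →₀ ℂ,
    eLpNorm (fun t => h t - p.sum fun m z => z * expo (-(m : ℤ)) t) 2
      (arc.withDensity fun t => ENNReal.ofReal (w t)) < ε

/-- `Δ(h; f, g)`: the mean-square error of the estimate of `Aξ` with spectral characteristic `h`
when the signal and the (uncorrelated) noise have spectral densities `f` and `g`, that is
`(1/2π) ∫ |A - h|² f dλ + (1/2π) ∫ |h|² g dλ`. -/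
def mse (a : ℕ → ℂ) (h : ℝ → ℂ) (f g : ℝ → ℝ) : ℝ≥0∞ :=
  ∫⁻ t, (‖transfer a t - h t‖ₑ ^ 2 * ENNReal.ofReal (f t)
    + ‖h t‖ₑ ^ 2 * ENNReal.ofReal (g t)) ∂arc

/-- `h` is the spectral characteristic of the mean-square optimal linear estimate of `Aξ` from the
observations `ξ(m) + η(m)`, `m ≤ 0`. -/
def IsOptimal (a : ℕ → ℂ) (f g : ℝ → ℝ) (h : ℝ → ℂ) : Prop :=
  MemPastL2 (fun t => f t + g t) h ∧
  ∀ h' : ℝ → ℂ, MemPastL2 (fun t => f t + g t) h' → mse a h f g ≤ mse a h' f g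

/-- `(f₀, g₀)` is least favorable in `D`: it maximizes the optimal error `Δ(h(f,g); f, g)`. -/
def IsLeastFavorable (a : ℕ → ℂ) (D : Set ((ℝ → ℝ) × (ℝ → ℝ))) (f₀ g₀ : ℝ → ℝ) : Prop :=
  (f₀, g₀) ∈ D ∧ ∃ h₀, IsOptimal a f₀ g₀ h₀ ∧
    ∀ q ∈ D, ∀ h, IsOptimal a q.1 q.2 h → mse a h q.1 q.2 ≤ mse a h₀ f₀ g₀

/-- `H_D`, the intersection of the spaces `L₂⁰(f + g)` over `(f, g) ∈ D`. -/
def commonPast (D : Set ((ℝ → ℝ) × (ℝ → ℝ))) : Set (ℝ → ℂ) :=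
  {h | ∀ q ∈ D, MemPastL2 (fun t => q.1 t + q.2 t) h}

/-- `h₀ ∈ H_D` and `min_{h ∈ H_D} sup_{(f,g) ∈ D} Δ(h; f, g) = sup_{(f,g) ∈ D} Δ(h₀; f, g)`. -/
def IsMinimaxRobust (a : ℕ → ℂ) (D : Set ((ℝ → ℝ) × (ℝ → ℝ))) (h₀ : ℝ → ℂ) : Prop :=
  h₀ ∈ commonPast D ∧
  IsLeast ((fun h : ℝ → ℂ => ⨆ q ∈ D, mse a h q.1 q.2) '' commonPast D)
    (⨆ q ∈ D, mse a h₀ q.1 q.2)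

/-! ### The matrices `P`, `R`, `Q` and the inverse of `P` -/

/-- `P_{k,j} = (1/2π) ∫ e^{iλ(j-k)} / (f + g) dλ`. -/
def matP (f g : ℝ → ℝ) (k j : ℕ) : ℂ :=
  ∫ t, expo ((j : ℤ) - k) t * ((1 / (f t + g t) : ℝ) : ℂ) ∂arc

/-- `R_{k,j} = (1/2π) ∫ e^{-iλ(j+k)} f / (f + g) dλ`. -/
def coefR (f g : ℝ → ℝ) (k j : ℕ) : ℂ :=
  ∫ t, expo (-((j : ℤ) + k)) t * ((f t / (f t + g t) : ℝ) : ℂ) ∂arc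

/-- `Q_{k,j} = (1/2π) ∫ e^{iλ(k-j)} f g / (f + g) dλ`. -/
def matQ (f g : ℝ → ℝ) (k j : ℕ) : ℂ :=
  ∫ t, expo ((k : ℤ) - j) t * ((f t * g t / (f t + g t) : ℝ) : ℂ) ∂arc

/-- The vector `R a`, where the operator `R` has the matrix `(R)_{l,m} = R_{l+1,m}`. -/
def vecRa (f g : ℝ → ℝ) (a : ℕ → ℂ) (l : ℕ) : ℂ := ∑' m : ℕ, coefR f g (l + 1) m * a m

/-- `⟨Q a, a⟩`. -/
def formQ (f g : ℝ → ℝ) (a : ℕ → ℂ) : ℂ :=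
  ∑' l : ℕ, (∑' k : ℕ, matQ f g l k * a k) * conj (a l)

/-- `⟨M x, x⟩` for a finitely supported `x`. -/
def quadForm (M : ℕ → ℕ → ℂ) (x : ℕ →₀ ℂ) : ℂ :=
  x.sum fun l z => (x.sum fun k y => M l k * y) * conj z

/-- The finitely supported vectors `x n` approximate `M⁻¹ r`: they form a Cauchy sequence for the
form `⟨M x, x⟩` of the positive matrix `M`, and `M (x n)` tends to `r` entrywise. The operator `M`
need not be bounded, nor `M⁻¹ r` square summable; if `M` is a bounded operator in `ℓ₂` and
`M c = r` with `c ∈ ℓ₂`, then the truncations of `c` are such a sequence. -/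
def ApproxInverse (M : ℕ → ℕ → ℂ) (r : ℕ → ℂ) (x : ℕ → ℕ →₀ ℂ) : Prop :=
  Tendsto (fun p : ℕ × ℕ => quadForm M (x p.1 - x p.2)) atTop (𝓝 0) ∧
  ∀ l, Tendsto (fun n => (x n).sum fun k y => M l k * y) atTop (𝓝 (r l))

/-- `c = M⁻¹ r`. -/
def IsInverseVector (M : ℕ → ℕ → ℂ) (r c : ℕ → ℂ) : Prop :=
  ∃ x, ApproxInverse M r x ∧ ∀ k, Tendsto (fun n => x n k) atTop (𝓝 (c k))

/-- `v = ⟨r, M⁻¹ r⟩`. -/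
def IsInverseForm (M : ℕ → ℕ → ℂ) (r : ℕ → ℂ) (v : ℝ) : Prop :=
  ∃ x, ApproxInverse M r x ∧
    Tendsto (fun n => (x n).sum fun l z => r l * conj z) atTop (𝓝 (v : ℂ))

/-- `C` is the function `∑_{k ≥ 0} c_k e^{iλ(k+1)}`: an integrable function with this Fourier
series. -/
def IsSeriesSum (c : ℕ → ℂ) (C : ℝ → ℂ) : Prop :=
  Integrable C arc ∧
  (∀ k : ℕ, ∫ t, C t * expo (-((k : ℤ) + 1)) t ∂arc = c k) ∧
  ∀ k : ℕ, ∫ t, C t * expo (k : ℤ) t ∂arc = 0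

/-- The function `(A f - C) / (f + g)`. -/
def specChar (a : ℕ → ℂ) (f g : ℝ → ℝ) (C : ℝ → ℂ) (t : ℝ) : ℂ :=
  (transfer a t * (f t : ℂ) - C t) / ((f t + g t : ℝ) : ℂ)

/-- `V = ⟨R a, P⁻¹ R a⟩ + ⟨Q a, a⟩`. -/
def IsObjectiveValue (a : ℕ → ℂ) (f g : ℝ → ℝ) (V : ℝ) : Prop :=
  ∃ v, IsInverseForm (matP f g) (vecRa f g a) v ∧ V = v + (formQ f g a).re

/-- `(f₀, g₀)` solves the problem of maximizing `⟨R a, P⁻¹ R a⟩ + ⟨Q a, a⟩` over the pairs in `D`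
for which `P` is defined, that is, those satisfying the minimality condition. -/
def SolvesOptimization (a : ℕ → ℂ) (D : Set ((ℝ → ℝ) × (ℝ → ℝ))) (f₀ g₀ : ℝ → ℝ) : Prop :=
  (f₀, g₀) ∈ D ∧ ∃ V₀, IsObjectiveValue a f₀ g₀ V₀ ∧
    ∀ q ∈ D, Minimality q.1 q.2 → ∀ V, IsObjectiveValue a q.1 q.2 V → V ≤ V₀

/-- The class of spectral densities `g` with `(1/2π) ∫ g dλ ≤ P₂`. -/
def powerClass (P₂ : ℝ) : Set (ℝ → ℝ) :=
  {g | IsSpectralDensity g ∧ ∫ t, g t ∂arc ≤ P₂}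

end Filtering

end

/-! Write w = f + g and multiply everything by √w, so that the problem lives in the unweighted L₂ of
the arc. Put u_k = e^{i(k+1)λ}/√w and G = Af/√w. Then P is the Gram matrix of the u_k and Ra is the
vector of the ⟨u_l, G⟩. The energy inverse therefore computes the orthogonal projection of G onto
the closed span of the u_k (`approxInverse_gram_iff`). Comparing Fourier coefficients shows that
this projection is C/√w (`seriesSum_ae`), and the objective equals ‖proj G‖² + ∫|A|²fg/w
(`isObjectiveValue_iff`).

Completing the square gives Δ(h; f, g) = ‖h√w − G‖² + ∫|A|²fg/w (`mse_eq`). For h in L₂⁰(w), the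
vector h√w is orthogonal to every u_k, so the error is at least the objective. Equality holds for
h√w = G − proj G, that is, for h = (Af − C)/w. This h has no positive frequencies and is bounded, so
its Cesàro means place it in L₂⁰ of every integrable weight (`memPastL2_of_bounded`). No minimality
is needed of the other pairs in the class.

It remains to prove the saddle inequality ∫|h|²g ≤ ∫|h|²g⁰ for g in the class. If g⁰ has full power
P₂, the formula for g⁰ says that |h| ≤ α₂, with equality where g⁰ > 0, and the inequality follows.
If some power is unused, it is added to g⁰ as white noise. The objective equals ∫|A|²f minus the
squared distance from G to the span, and the larger weight strictly decreases that distance unless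
Af = C (`IsMinimalPair.ae_eq_of_objective_le`). Maximality of the objective thus forces h = 0, and
the inequality is trivial. -/

namespace Filtering

/-! ### Gram matrices and the energy inverse -/

section Gram

variable {H : Type*} [NormedAddCommGroup H] [InnerProductSpace ℂ H]

/-- The closed span of a sequence of vectors. -/
abbrev closedSpan (U : ℕ → H) : Submodule ℂ H :=
  (Submodule.span ℂ (Set.range U)).topologicalClosure

lemma sum_gram_mul (U : ℕ → H) (l : ℕ) (x : ℕ →₀ ℂ) :
    (x.sum fun k y => inner ℂ (U l) (U k) * y) =
      inner ℂ (U l) (Finsupp.linearCombination ℂ U x) := by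
  rw [Finsupp.linearCombination_apply, Finsupp.sum, Finsupp.sum, inner_sum]
  exact Finset.sum_congr rfl fun k _ => by rw [inner_smul_right, mul_comm]

lemma sum_inner_mul_conj (U : ℕ → H) (G : H) (x : ℕ →₀ ℂ) :
    (x.sum fun l z => inner ℂ (U l) G * conj z) =
      inner ℂ (Finsupp.linearCombination ℂ U x) G := by
  rw [Finsupp.linearCombination_apply, Finsupp.sum, Finsupp.sum, sum_inner]
  exact Finset.sum_congr rfl fun k _ => by rw [inner_smul_left, mul_comm]

lemma quadForm_gram (U : ℕ → H) (x : ℕ →₀ ℂ) :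
    quadForm (fun l k => inner ℂ (U l) (U k)) x =
      ((‖Finsupp.linearCombination ℂ U x‖ ^ 2 : ℝ) : ℂ) := by
  unfold quadForm
  simp_rw [sum_gram_mul]
  rw [sum_inner_mul_conj, inner_self_eq_norm_sq_to_K]
  norm_cast

lemma linearCombination_mem_closedSpan (U : ℕ → H) (x : ℕ →₀ ℂ) :
    Finsupp.linearCombination ℂ U x ∈ closedSpan U :=
  Submodule.le_topologicalClosure _ <| by
    rw [← Finsupp.range_linearCombination]; exact ⟨x, rfl⟩

lemma mem_closedSpan_iff (U : ℕ → H) (D : H) :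
    D ∈ closedSpan U ↔ ∃ x : ℕ → ℕ →₀ ℂ,
      Tendsto (fun n => Finsupp.linearCombination ℂ U (x n)) atTop (𝓝 D) := by
  constructor
  · intro h
    obtain ⟨u, hu, hlim⟩ := mem_closure_iff_seq_limit.1
      (show D ∈ closure (Submodule.span ℂ (Set.range U) : Set H) from h)
    choose x hx using fun n => (Finsupp.mem_span_range_iff_exists_finsupp).1 (hu n)
    refine ⟨x, ?_⟩
    simp_rw [Finsupp.linearCombination_apply, hx]
    exact hlim
  · rintro ⟨x, hx⟩
    exact (Submodule.isClosed_topologicalClosure _).mem_of_tendsto hx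
      (Eventually.of_forall fun n => linearCombination_mem_closedSpan U _)

lemma inner_eq_zero_of_mem_closedSpan {U : ℕ → H} {D v : H} (hD : D ∈ closedSpan U)
    (h : ∀ l, inner ℂ (U l) v = 0) : inner ℂ D v = 0 := by
  obtain ⟨x, hx⟩ := (mem_closedSpan_iff U D).1 hD
  refine tendsto_nhds_unique (hx.inner tendsto_const_nhds) ?_
  simp_rw [← sum_inner_mul_conj, h]
  simp

variable [CompleteSpace H]

instance (U : ℕ → H) : CompleteSpace (closedSpan U) :=
  (Submodule.isClosed_topologicalClosure _).completeSpace_coe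

/-- The projection onto the closed span of a sequence of vectors. -/
noncomputable def proj (U : ℕ → H) (G : H) : H := (closedSpan U).starProjection G

lemma proj_mem (U : ℕ → H) (G : H) : proj U G ∈ closedSpan U :=
  Submodule.starProjection_apply_mem _ _

lemma inner_proj (U : ℕ → H) (G : H) {D : H} (hD : D ∈ closedSpan U) :
    inner ℂ D (proj U G) = inner ℂ D G := by
  have := Submodule.starProjection_inner_eq_zero (K := closedSpan U) G D hD
  rw [inner_eq_zero_symm, inner_sub_right, sub_eq_zero] at this
  exact this.symm

/-- The form of a Gram matrix is the squared norm of the linear combination, so energy-Cauchy means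
norm-Cauchy and completeness supplies a limit. Entrywise convergence makes G minus that limit
orthogonal to every `U l`, which characterizes the projection. -/
lemma approxInverse_gram_iff (U : ℕ → H) (G : H) (x : ℕ → ℕ →₀ ℂ) :
    ApproxInverse (fun l k => inner ℂ (U l) (U k)) (fun l => inner ℂ (U l) G) x ↔
      Tendsto (fun n => Finsupp.linearCombination ℂ U (x n)) atTop (𝓝 (proj U G)) := by
  have hq (p : ℕ × ℕ) : quadForm (fun l k => inner ℂ (U l) (U k)) (x p.1 - x p.2) =
      ((dist (Finsupp.linearCombination ℂ U (x p.1))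
        (Finsupp.linearCombination ℂ U (x p.2)) ^ 2 : ℝ) : ℂ) := by
    rw [quadForm_gram, map_sub, dist_eq_norm]
  constructor
  · rintro ⟨h1, h2⟩
    simp_rw [hq] at h1
    have h3 : Tendsto (fun p : ℕ × ℕ => dist (Finsupp.linearCombination ℂ U (x p.1))
        (Finsupp.linearCombination ℂ U (x p.2))) atTop (𝓝 0) := by
      have := ((Complex.continuous_re.tendsto _).comp h1).sqrt
      simpa only [Function.comp_def, Complex.ofReal_re, Real.sqrt_sq dist_nonneg, Complex.zero_re,
        Real.sqrt_zero] using this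
    obtain ⟨D, hD⟩ := cauchySeq_tendsto_of_complete
      (u := fun n => Finsupp.linearCombination ℂ U (x n)) (cauchySeq_iff_tendsto_dist_atTop_0.2 h3)
    have hDK : D ∈ closedSpan U := (mem_closedSpan_iff U D).2 ⟨x, hD⟩
    have hin (l : ℕ) : inner ℂ (U l) (G - D) = 0 := by
      have h4 := h2 l
      simp_rw [sum_gram_mul] at h4
      rw [inner_sub_right, sub_eq_zero]
      exact tendsto_nhds_unique h4 (tendsto_const_nhds.inner hD)
    have : proj U G = D := Submodule.eq_starProjection_of_mem_of_inner_eq_zero hDK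
      fun w hw => by
        rw [inner_eq_zero_symm]
        exact inner_eq_zero_of_mem_closedSpan hw hin
    rwa [this]
  · intro h
    refine ⟨?_, fun l => ?_⟩
    · simp_rw [hq]
      have := (Complex.continuous_ofReal.tendsto _).comp
        ((cauchySeq_iff_tendsto_dist_atTop_0.1 h.cauchySeq).pow 2)
      simpa [Function.comp_def] using this
    · simp_rw [sum_gram_mul]
      have : inner ℂ (U l) G = inner ℂ (U l) (proj U G) :=
        (inner_proj U G (Submodule.le_topologicalClosure _
          (Submodule.subset_span ⟨l, rfl⟩))).symm
      rw [this]
      exact tendsto_const_nhds.inner h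

/-- The pairings tend to ⟨proj G, G⟩ = ‖proj G‖². The value therefore exists and is independent of
the approximating sequence. -/
lemma isInverseForm_gram_iff (U : ℕ → H) (G : H) (v : ℝ) :
    IsInverseForm (fun l k => inner ℂ (U l) (U k)) (fun l => inner ℂ (U l) G) v ↔
      v = ‖proj U G‖ ^ 2 := by
  have key {x : ℕ → ℕ →₀ ℂ}
      (hx : Tendsto (fun n => Finsupp.linearCombination ℂ U (x n)) atTop (𝓝 (proj U G))) :
      Tendsto (fun n => (x n).sum fun l z => inner ℂ (U l) G * conj z) atTop
        (𝓝 ((‖proj U G‖ ^ 2 : ℝ) : ℂ)) := by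
    simp_rw [sum_inner_mul_conj]
    have : ((‖proj U G‖ ^ 2 : ℝ) : ℂ) = inner ℂ (proj U G) G := by
      rw [← inner_proj U G (proj_mem U G), inner_self_eq_norm_sq_to_K]
      norm_cast
    rw [this]
    exact hx.inner tendsto_const_nhds
  constructor
  · rintro ⟨x, hx, hv⟩
    exact Complex.ofReal_injective
      (tendsto_nhds_unique hv (key ((approxInverse_gram_iff U G x).1 hx)))
  · rintro rfl
    obtain ⟨x, hx⟩ := (mem_closedSpan_iff U _).1 (proj_mem U G)
    exact ⟨x, (approxInverse_gram_iff U G x).2 hx, key hx⟩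

/-- A vector of the closed span bounds the energy of the projection from below. -/
lemma le_norm_proj_sq (U : ℕ → H) (G : H) {D : H} (hD : D ∈ closedSpan U) :
    ‖G‖ ^ 2 - ‖G - D‖ ^ 2 ≤ ‖proj U G‖ ^ 2 := by
  have h1 : ‖G - D‖ ^ 2 = ‖G‖ ^ 2 - 2 * (inner ℂ D G).re + ‖D‖ ^ 2 := by
    rw [@norm_sub_sq ℂ, ← inner_conj_symm G D, RCLike.conj_re, RCLike.re_to_complex]
  have h2 : ‖proj U G - D‖ ^ 2 = ‖proj U G‖ ^ 2 - 2 * (inner ℂ D G).re + ‖D‖ ^ 2 := by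
    rw [@norm_sub_sq ℂ, ← inner_conj_symm _ D, inner_proj U G hD, RCLike.conj_re,
      RCLike.re_to_complex]
  -- The two sides differ by exactly ‖proj G − D‖².
  nlinarith [sq_nonneg ‖proj U G - D‖]

end Gram

/-! ### Fourier analysis on the arc -/

instance : IsProbabilityMeasure arc := ⟨by
  unfold arc
  rw [Measure.smul_apply, Measure.restrict_apply_univ, Real.volume_Ioc, smul_eq_mul,
    ← ENNReal.ofReal_mul (by positivity)]
  have := Real.pi_pos
  rw [show 1 / (2 * Real.pi) * (Real.pi - -Real.pi) = 1 by field_simp; ring, ENNReal.ofReal_one]⟩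

lemma ae_arc_iff {p : ℝ → Prop} :
    (∀ᵐ t ∂arc, p t) ↔ ∀ᵐ t ∂volume.restrict (Set.Ioc (-Real.pi) Real.pi), p t := by
  unfold arc
  rw [Measure.ae_ennreal_smul_measure_iff]
  have := Real.pi_pos
  simp [this]

lemma integral_arc (F : ℝ → ℂ) :
    ∫ t, F t ∂arc = ((1 / (2 * Real.pi) : ℝ) : ℂ) * ∫ t in Set.Ioc (-Real.pi) Real.pi, F t := by
  unfold arc
  rw [integral_smul_measure, ENNReal.toReal_ofReal (by positivity), Complex.real_smul]

lemma expo_add (m n : ℤ) (t : ℝ) : expo (m + n) t = expo m t * expo n t := by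
  unfold expo
  rw [← Complex.exp_add]
  congr 1
  push_cast
  ring

lemma expo_zero (t : ℝ) : expo 0 t = 1 := by simp [expo]

lemma conj_expo (m : ℤ) (t : ℝ) : conj (expo m t) = expo (-m) t := by
  unfold expo
  rw [← Complex.exp_conj]
  congr 1
  simp

lemma norm_expo (m : ℤ) (t : ℝ) : ‖expo m t‖ = 1 := by
  unfold expo
  rw [show Complex.I * m * t = ((m * t : ℝ) : ℂ) * Complex.I by push_cast; ring]
  exact Complex.norm_exp_ofReal_mul_I _

@[fun_prop]
lemma continuous_expo (m : ℤ) : Continuous (expo m) := by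
  unfold expo
  fun_prop

lemma fourier_eq_expo (m : ℤ) (t : ℝ) :
    (fourier m (t : AddCircle (2 * Real.pi)) : ℂ) = expo m t := by
  rw [fourier_coe_apply]
  unfold expo
  congr 1
  have := Real.pi_ne_zero
  push_cast
  field_simp

lemma integral_expo (m : ℤ) : ∫ t, expo m t ∂arc = if m = 0 then 1 else 0 := by
  split_ifs with h
  · subst h
    simp [expo_zero]
  · rw [integral_arc, ← intervalIntegral.integral_of_le (by linarith [Real.pi_pos])]
    have hm : (Complex.I * m : ℂ) ≠ 0 := by simp [h]
    have : ∫ t in (-Real.pi)..Real.pi, expo m t = 0 := by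
      unfold expo
      rw [integral_exp_mul_complex hm, div_eq_zero_iff, sub_eq_zero]
      left
      rw [Complex.exp_eq_exp_iff_exists_int]
      exact ⟨m, by push_cast; ring⟩
    rw [this, mul_zero]

lemma integrable_mul_expo {F : ℝ → ℂ} (hF : Integrable F arc) (m : ℤ) :
    Integrable (fun t => F t * expo m t) arc :=
  hF.mul_bdd (c := 1) (continuous_expo m).aestronglyMeasurable
    (Eventually.of_forall fun t => (norm_expo m t).le)

/-- An integrable function is determined by its Fourier coefficients. -/
lemma ae_eq_zero_of_fourier {F : ℝ → ℂ} (hF : Integrable F arc)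
    (h : ∀ m : ℤ, ∫ t, F t * expo m t ∂arc = 0) : ∀ᵐ t ∂arc, F t = 0 := by
  have hpi := Real.pi_pos
  have : Fact (0 < 2 * Real.pi) := ⟨by positivity⟩
  have hcont (φ : C(AddCircle (2 * Real.pi), ℂ)) :
      Continuous fun t : ℝ => φ (t : AddCircle (2 * Real.pi)) :=
    φ.continuous.comp (AddCircle.continuous_mk' _)
  have hint (φ : C(AddCircle (2 * Real.pi), ℂ)) :
      Integrable (fun t => F t * φ (t : AddCircle (2 * Real.pi))) arc :=
    hF.mul_bdd (c := ‖φ‖) (hcont φ).aestronglyMeasurable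
      (Eventually.of_forall fun t => φ.norm_coe_le_norm _)
  -- Integration against F is a bounded functional on continuous functions of the circle. It kills
  -- the exponentials, whose span is dense, hence it is zero.
  let T : C(AddCircle (2 * Real.pi), ℂ) →ₗ[ℂ] ℂ :=
    { toFun := fun φ => ∫ t, F t * φ (t : AddCircle (2 * Real.pi)) ∂arc
      map_add' := fun φ ψ => by
        rw [← integral_add (hint φ) (hint ψ)]
        simp [mul_add]
      map_smul' := fun c φ => by
        rw [RingHom.id_apply, smul_eq_mul, ← integral_const_mul]
        congr 1
        ext t
        simp only [ContinuousMap.coe_smul, Pi.smul_apply, smul_eq_mul]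
        ring }
  let Tc : C(AddCircle (2 * Real.pi), ℂ) →L[ℂ] ℂ := T.mkContinuous (∫ t, ‖F t‖ ∂arc) fun φ => by
    calc ‖∫ t, F t * φ (t : AddCircle (2 * Real.pi)) ∂arc‖
        ≤ ∫ t, ‖F t‖ * ‖φ‖ ∂arc := norm_integral_le_of_norm_le (hF.norm.mul_const _)
          (Eventually.of_forall fun t => by
            rw [norm_mul]
            exact mul_le_mul_of_nonneg_left (φ.norm_coe_le_norm _) (norm_nonneg _))
      _ = (∫ t, ‖F t‖ ∂arc) * ‖φ‖ := integral_mul_const _ _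
  have hTc : Tc = 0 := by
    refine ContinuousLinearMap.ext_on
      (Submodule.dense_iff_topologicalClosure_eq_top.2
        (span_fourier_closure_eq_top (T := 2 * Real.pi))) ?_
    rintro _ ⟨m, rfl⟩
    show ∫ t, F t * fourier m (t : AddCircle (2 * Real.pi)) ∂arc = 0
    simp_rw [fourier_eq_expo]
    exact h m
  have hF' : IntegrableOn F (Set.Ioc (-Real.pi) Real.pi) := by
    have := hF
    unfold arc at this
    rwa [integrable_smul_measure (by simp [hpi]) (by simp)] at this
  have hU := isOpen_Ioo.ae_eq_zero_of_integral_contDiff_smul_eq_zero (f := F) (μ := volume)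
    (U := Set.Ioo (-Real.pi) Real.pi)
    ((hF'.mono_set Set.Ioo_subset_Ioc_self).locallyIntegrableOn) ?_
  · rw [ae_arc_iff, ← Measure.restrict_congr_set Ioo_ae_eq_Ioc,
      ae_restrict_iff' measurableSet_Ioo]
    exact hU
  · intro g hg _ hsupp
    have hzero {t : ℝ} (ht : t ∉ Set.Ioo (-Real.pi) Real.pi) : g t = 0 :=
      image_eq_zero_of_notMem_tsupport fun h => ht (hsupp h)
    -- A test function supported in the open interval vanishes at both ends, so it descends to a
    -- continuous function on the circle.
    have hends : (fun t => (g t : ℂ)) (-Real.pi) =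
        (fun t => (g t : ℂ)) (-Real.pi + 2 * Real.pi) := by
      simp only
      rw [hzero (by simp), hzero (by simp; intro; linarith)]
    let φ : C(AddCircle (2 * Real.pi), ℂ) :=
      ⟨AddCircle.liftIoc (2 * Real.pi) (-Real.pi) fun t => (g t : ℂ),
        AddCircle.liftIoc_continuous hends
          (Complex.continuous_ofReal.comp hg.continuous).continuousOn⟩
    have hφ : Tc φ = 0 := by rw [hTc]; rfl
    have hφ' : ∫ t, F t * φ (t : AddCircle (2 * Real.pi)) ∂arc = 0 := hφ
    rw [integral_arc, mul_eq_zero] at hφ'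
    have h2 := hφ'.resolve_left (by simp [hpi.ne'])
    have hsub : ∫ t, g t • F t = ∫ t in Set.Ioc (-Real.pi) Real.pi, g t • F t := by
      symm
      refine setIntegral_eq_integral_of_forall_compl_eq_zero fun t ht => ?_
      rw [hzero fun h => ht (Set.Ioo_subset_Ioc_self h), zero_smul]
    rw [hsub, ← h2]
    refine setIntegral_congr_fun measurableSet_Ioc fun t ht => ?_
    have : φ (t : AddCircle (2 * Real.pi)) = (g t : ℂ) :=
      AddCircle.liftIoc_coe_apply (f := fun t => (g t : ℂ)) (by
        rwa [show -Real.pi + 2 * Real.pi = Real.pi by ring])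
    simp only [this, Complex.real_smul, mul_comm]

/-! ### The space `L₂` of the arc -/

lemma inner_toLp {u v : ℝ → ℂ} (hu : MemLp u 2 arc) (hv : MemLp v 2 arc) :
    inner ℂ (hu.toLp u) (hv.toLp v) = ∫ t, conj (u t) * v t ∂arc := by
  rw [L2.inner_def]
  refine integral_congr_ae ?_
  filter_upwards [hu.coeFn_toLp, hv.coeFn_toLp] with t h1 h2
  rw [h1, h2, RCLike.inner_apply, mul_comm]

lemma norm_toLp_sq {u : ℝ → ℂ} (hu : MemLp u 2 arc) :
    ‖hu.toLp u‖ ^ 2 = ∫ t, ‖u t‖ ^ 2 ∂arc := by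
  have h : ((‖hu.toLp u‖ ^ 2 : ℝ) : ℂ) = ((∫ t, ‖u t‖ ^ 2 ∂arc : ℝ) : ℂ) := by
    have := inner_self_eq_norm_sq_to_K (𝕜 := ℂ) (hu.toLp u)
    rw [inner_toLp] at this
    push_cast
    rw [← integral_complex_ofReal]
    refine Eq.trans ?_ (this.symm.trans ?_)
    · norm_cast
    · refine integral_congr_ae (Eventually.of_forall fun t => ?_)
      simp only [RCLike.conj_mul]
      norm_cast
  exact_mod_cast h

lemma coeFn_linearCombination_toLp {ι : Type*} {F : ι → ℝ → ℂ} (hF : ∀ i, MemLp (F i) 2 arc)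
    (x : ι →₀ ℂ) :
    (Finsupp.linearCombination ℂ (fun i => (hF i).toLp (F i)) x : ℝ → ℂ) =ᵐ[arc]
      fun t => x.sum fun i z => z * F i t := by
  induction x using Finsupp.induction_linear with
  | zero =>
    filter_upwards [Lp.coeFn_zero ℂ 2 arc] with t ht
    rw [map_zero, ht, Finsupp.sum_zero_index, Pi.zero_apply]
  | add x y hx hy =>
    rw [map_add]
    filter_upwards [hx, hy, Lp.coeFn_add
      (Finsupp.linearCombination ℂ (fun i => (hF i).toLp (F i)) x)
      (Finsupp.linearCombination ℂ (fun i => (hF i).toLp (F i)) y)] with t h1 h2 h3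
    rw [h3, Pi.add_apply, h1, h2, Finsupp.sum_add_index' (by simp) (by intros; ring)]
  | single i z =>
    rw [Finsupp.linearCombination_single]
    filter_upwards [Lp.coeFn_smul z ((hF i).toLp (F i)), (hF i).coeFn_toLp] with t h1 h2
    rw [h1, Pi.smul_apply, h2, Finsupp.sum_single_index (by simp), smul_eq_mul]

lemma memLp_expo (m : ℤ) : MemLp (expo m) 2 arc :=
  MemLp.of_bound (continuous_expo m).aestronglyMeasurable 1
    (Eventually.of_forall fun t => (norm_expo m t).le)

/-- The exponential `e^{imλ}` as a vector of `L₂`. -/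
noncomputable def expoLp (m : ℤ) : Lp ℂ 2 arc := (memLp_expo m).toLp (expo m)

lemma inner_expoLp (m : ℤ) {u : ℝ → ℂ} (hu : MemLp u 2 arc) :
    inner ℂ (expoLp m) (hu.toLp u) = ∫ t, u t * expo (-m) t ∂arc := by
  unfold expoLp
  rw [inner_toLp]
  simp_rw [conj_expo, mul_comm]

lemma orthonormal_expoLp : Orthonormal ℂ expoLp := by
  rw [orthonormal_iff_ite]
  intro m n
  rw [show expoLp n = (memLp_expo n).toLp (expo n) from rfl, inner_expoLp]
  simp_rw [← expo_add, integral_expo]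
  refine if_congr ?_ rfl rfl
  omega

lemma span_expoLp_orthogonal : (Submodule.span ℂ (Set.range expoLp))ᗮ = ⊥ := by
  rw [Submodule.eq_bot_iff]
  intro u hu
  rw [Submodule.mem_orthogonal] at hu
  have h : ∀ᵐ t ∂arc, u t = 0 := by
    refine ae_eq_zero_of_fourier ((Lp.memLp u).integrable (by norm_num)) fun m => ?_
    have := hu (expoLp (-m)) (Submodule.subset_span ⟨-m, rfl⟩)
    rwa [← Lp.toLp_coeFn u (Lp.memLp u), inner_expoLp, neg_neg] at this
  exact (Lp.eq_zero_iff_ae_eq_zero).2 h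

/-- The exponentials form a Hilbert basis. -/
noncomputable def expoBasis : HilbertBasis ℤ ℂ (Lp ℂ 2 arc) :=
  HilbertBasis.mkOfOrthogonalEqBot orthonormal_expoLp span_expoLp_orthogonal

lemma hasSum_expoLp {h : ℝ → ℂ} (hh : MemLp h 2 arc) :
    HasSum (fun m : ℤ => (∫ t, h t * expo (-m) t ∂arc) • expoLp m) (hh.toLp h) := by
  have := expoBasis.hasSum_repr (hh.toLp h)
  simp_rw [HilbertBasis.repr_apply_apply] at this
  simpa only [expoBasis, HilbertBasis.coe_mkOfOrthogonalEqBot, inner_expoLp] using this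

/-! ### Cesàro means of functions without positive frequencies -/

/-- The coefficients of the Cesàro means of the Fourier series of `h`, a function without positive
frequencies. -/
noncomputable def cesaroMean (h : ℝ → ℂ) (N : ℕ) : ℕ →₀ ℂ :=
  ∑ j ∈ Finset.range N, ∑ m ∈ Finset.range (j + 1),
    Finsupp.single m ((N : ℂ)⁻¹ * ∫ t, h t * expo (m : ℤ) t ∂arc)

lemma tendsto_cesaroMean {h : ℝ → ℂ} (hh : MemLp h 2 arc)
    (hpos : ∀ k : ℕ, ∫ t, h t * expo (-((k : ℤ) + 1)) t ∂arc = 0) :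
    Tendsto (fun N => Finsupp.linearCombination ℂ (fun m : ℕ => expoLp (-(m : ℤ)))
      (cesaroMean h N)) atTop (𝓝 (hh.toLp h)) := by
  have hinj : Function.Injective fun m : ℕ => -(m : ℤ) := fun m n hmn => by
    simpa using hmn
  have h1 : HasSum (fun m : ℕ => (∫ t, h t * expo (m : ℤ) t ∂arc) • expoLp (-(m : ℤ)))
      (hh.toLp h) := by
    have := (hinj.hasSum_iff ?_).2 (hasSum_expoLp hh)
    · simpa [Function.comp_def] using this
    · intro m hm
      obtain ⟨k, hk⟩ : ∃ k : ℕ, m = (k : ℤ) + 1 := by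
        refine ⟨(m - 1).toNat, ?_⟩
        by_contra hcon
        exact hm ⟨(-m).toNat, by simp only; omega⟩
      rw [hk, hpos, zero_smul]
  -- The shift by one makes the j-th partial sum run over the frequencies 0, …, −j, as in
  -- `cesaroMean`.
  have h2 := ((tendsto_add_atTop_iff_nat 1).2 h1.tendsto_sum_nat).cesaro_smul
  refine h2.congr fun N => ?_
  unfold cesaroMean
  rw [map_sum, Finset.smul_sum]
  refine Finset.sum_congr rfl fun j _ => ?_
  rw [map_sum, Finset.smul_sum]
  refine Finset.sum_congr rfl fun m _ => ?_
  rw [Finsupp.linearCombination_single, mul_smul, ← algebraMap_smul ℂ (N : ℝ)⁻¹]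
  simp

/-- The left side is N times the Fejér kernel at s − t, in a form that is visibly nonnegative. -/
lemma norm_sq_sum_expo (N : ℕ) (t s : ℝ) :
    ((‖∑ j ∈ Finset.range N, expo (j : ℤ) s * expo (-(j : ℤ)) t‖ ^ 2 : ℝ) : ℂ) =
      ∑ j ∈ Finset.range N, ∑ k ∈ Finset.range N,
        expo ((j : ℤ) - k) s * expo (-((j : ℤ) - k)) t := by
  have := RCLike.mul_conj (∑ j ∈ Finset.range N, expo (j : ℤ) s * expo (-(j : ℤ)) t)
  push_cast
  refine Eq.trans this.symm ?_
  rw [map_sum, Finset.sum_mul_sum]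
  refine Finset.sum_congr rfl fun j _ => Finset.sum_congr rfl fun k _ => ?_
  rw [map_mul, conj_expo, conj_expo, sub_eq_add_neg, expo_add, neg_add, expo_add]
  ring

lemma integral_norm_sq_sum_expo (N : ℕ) (t : ℝ) :
    ∫ s, ‖∑ j ∈ Finset.range N, expo (j : ℤ) s * expo (-(j : ℤ)) t‖ ^ 2 ∂arc = N := by
  have h : ((∫ s, ‖∑ j ∈ Finset.range N, expo (j : ℤ) s * expo (-(j : ℤ)) t‖ ^ 2 ∂arc : ℝ) : ℂ) =
      ((N : ℝ) : ℂ) := by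
    rw [← integral_complex_ofReal]
    simp_rw [norm_sq_sum_expo]
    have hi (m n : ℤ) : Integrable (fun s => expo m s * expo n t) arc :=
      ((memLp_expo m).integrable (by norm_num)).mul_const _
    rw [integral_finsetSum _ fun j _ => integrable_finsetSum _ fun k _ => hi _ _]
    have : ∀ j ∈ Finset.range N, ∫ s, ∑ k ∈ Finset.range N,
        expo ((j : ℤ) - k) s * expo (-((j : ℤ) - k)) t ∂arc = 1 := by
      intro j hj
      rw [integral_finsetSum _ fun k _ => hi _ _]
      simp_rw [integral_mul_const, integral_expo, sub_eq_zero, Nat.cast_inj]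
      simp only [ite_mul, one_mul, zero_mul]
      rw [Finset.sum_ite_eq, if_pos hj]
      simp [expo_zero]
    rw [Finset.sum_congr rfl this]
    simp
  exact_mod_cast h

/-- The usual convolution with the Fejér kernel; the terms with k > j carry positive frequencies of
h and vanish. -/
lemma cesaroMean_eq_integral {h : ℝ → ℂ} (hh : Integrable h arc)
    (hpos : ∀ k : ℕ, ∫ t, h t * expo (-((k : ℤ) + 1)) t ∂arc = 0) (N : ℕ) (t : ℝ) :
    ((cesaroMean h N).sum fun m z => z * expo (-(m : ℤ)) t) =
      (N : ℂ)⁻¹ * ∫ s, h s *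
        ((‖∑ j ∈ Finset.range N, expo (j : ℤ) s * expo (-(j : ℤ)) t‖ ^ 2 : ℝ) : ℂ) ∂arc := by
  have hi (m n : ℤ) : Integrable (fun s => h s * (expo m s * expo n t)) arc := by
    simp_rw [← mul_assoc]
    exact (integrable_mul_expo hh m).mul_const _
  simp_rw [norm_sq_sum_expo, Finset.mul_sum]
  rw [integral_finsetSum _ fun j _ => integrable_finsetSum _ fun k _ => hi _ _]
  have hl : ((cesaroMean h N).sum fun m z => z * expo (-(m : ℤ)) t) =
      Finsupp.linearCombination ℂ (fun m : ℕ => expo (-(m : ℤ)) t) (cesaroMean h N) := by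
    rw [Finsupp.linearCombination_apply]
    rfl
  rw [hl, cesaroMean, map_sum, Finset.mul_sum]
  refine Finset.sum_congr rfl fun j hj => ?_
  rw [integral_finsetSum _ fun k _ => hi _ _, map_sum, Finset.mul_sum]
  simp_rw [← mul_assoc, integral_mul_const, Finsupp.linearCombination_single, smul_eq_mul]
  -- Only k ≤ j contributes, and the reflection k ↦ j − k matches the two sums.
  rw [← Finset.sum_subset (Finset.range_mono (Nat.succ_le_of_lt (Finset.mem_range.1 hj))),
    ← Finset.sum_range_reflect]
  · refine Finset.sum_congr rfl fun k hk => ?_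
    have hk' := Finset.mem_range.1 hk
    have : (((j + 1 - 1 - k : ℕ)) : ℤ) = (j : ℤ) - k := by omega
    rw [this, mul_assoc]
  · intro k _ hk
    have hk' : j + 1 ≤ k := by simpa using hk
    obtain ⟨d, hd⟩ := Nat.exists_eq_add_of_le hk'
    have : (j : ℤ) - k = -((d : ℤ) + 1) := by rw [hd]; push_cast; ring
    rw [this, hpos, zero_mul, mul_zero]

/-- The Fejér kernel is nonnegative with mean one, so averaging against it preserves the bound. -/
lemma norm_cesaroMean_le {h : ℝ → ℂ} (hh : AEStronglyMeasurable h arc) {M : ℝ}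
    (hM : ∀ᵐ t ∂arc, ‖h t‖ ≤ M)
    (hpos : ∀ k : ℕ, ∫ t, h t * expo (-((k : ℤ) + 1)) t ∂arc = 0) (N : ℕ) (t : ℝ) :
    ‖(cesaroMean h N).sum fun m z => z * expo (-(m : ℤ)) t‖ ≤ M := by
  have hM0 : 0 ≤ M := by
    obtain ⟨t, ht⟩ := hM.exists
    exact (norm_nonneg _).trans ht
  rw [cesaroMean_eq_integral (Integrable.of_bound hh M hM) hpos]
  rcases Nat.eq_zero_or_pos N with rfl | hN
  · simpa using hM0
  have hN' : (0 : ℝ) < N := by exact_mod_cast hN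
  rw [norm_mul, norm_inv, Complex.norm_natCast, inv_mul_le_iff₀ hN']
  have hcont : Continuous fun s =>
      ‖∑ j ∈ Finset.range N, expo (j : ℤ) s * expo (-(j : ℤ)) t‖ ^ 2 := by fun_prop
  have hint : Integrable (fun s =>
      ‖∑ j ∈ Finset.range N, expo (j : ℤ) s * expo (-(j : ℤ)) t‖ ^ 2) arc := by
    -- A non-integrable function would have integral 0 by convention, but the integral is N > 0.
    by_contra hcon
    have := integral_norm_sq_sum_expo N t
    rw [integral_undef hcon] at this
    exact hN'.ne this
  calc _ ≤ ∫ s, M * ‖∑ j ∈ Finset.range N, expo (j : ℤ) s * expo (-(j : ℤ)) t‖ ^ 2 ∂arc := by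
        refine norm_integral_le_of_norm_le (hint.const_mul M) ?_
        filter_upwards [hM] with s hs
        rw [norm_mul, Complex.norm_real, Real.norm_of_nonneg (by positivity)]
        exact mul_le_mul_of_nonneg_right hs (by positivity)
    _ = N * M := by rw [integral_const_mul, integral_norm_sq_sum_expo, mul_comm]

/-- A bounded function without positive frequencies belongs to `L₂⁰(w)` for every integrable
weight `w`. -/
theorem memPastL2_of_bounded {h : ℝ → ℂ} (hh : AEStronglyMeasurable h arc) {M : ℝ}
    (hM : ∀ᵐ t ∂arc, ‖h t‖ ≤ M)
    (hpos : ∀ k : ℕ, ∫ t, h t * expo (-((k : ℤ) + 1)) t ∂arc = 0)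
    {w : ℝ → ℝ} (hw : Integrable w arc) : MemPastL2 w h := by
  have hac : arc.withDensity (fun t => ENNReal.ofReal (w t)) ≪ arc :=
    withDensity_absolutelyContinuous _ _
  have hfin : IsFiniteMeasure (arc.withDensity fun t => ENNReal.ofReal (w t)) :=
    isFiniteMeasure_withDensity_ofReal hw.2
  set ν := arc.withDensity fun t => ENNReal.ofReal (w t) with hν
  refine ⟨MemLp.of_bound (hh.mono_ac hac) M (hac.ae_le hM), fun ε hε => ?_⟩
  have hh2 : MemLp h 2 arc := MemLp.of_bound hh M hM
  let p : ℕ → ℝ → ℂ := fun N t => (cesaroMean h N).sum fun m z => z * expo (-(m : ℤ)) t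
  have hp (N : ℕ) : Continuous (p N) := by
    simp only [p, Finsupp.sum]
    fun_prop
  -- Since w may be unbounded, L₂ convergence on the arc does not transfer to L₂(w). Almost
  -- everywhere convergence along a subsequence does.
  obtain ⟨φ, -, hφ⟩ :=
    (tendstoInMeasure_of_tendsto_Lp (tendsto_cesaroMean hh2 hpos)).exists_seq_tendsto_ae
  have hlim : ∀ᵐ t ∂ν, Tendsto (fun n => p (φ n) t) atTop (𝓝 (h t)) := by
    refine hac.ae_le ?_
    have hco : ∀ᵐ t ∂arc, ∀ N, (Finsupp.linearCombination ℂ (fun m : ℕ => expoLp (-(m : ℤ)))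
        (cesaroMean h N) : ℝ → ℂ) t = p N t :=
      ae_all_iff.2 fun N =>
        coeFn_linearCombination_toLp (fun m : ℕ => memLp_expo (-(m : ℤ))) (cesaroMean h N)
    filter_upwards [hφ, hco, hh2.coeFn_toLp] with t h1 h2 h3
    rw [h3] at h1
    exact h1.congr fun n => h2 _
  -- Both h and its means are bounded by M, so the constant (2M)² dominates; it is integrable
  -- because the weighted measure is finite.
  have hL : Tendsto (fun n => ∫⁻ t, ‖h t - p (φ n) t‖ₑ ^ (2 : ℝ) ∂ν) atTop (𝓝 0) := by
    have := tendsto_lintegral_of_dominated_convergence' (μ := ν)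
      (F := fun n t => ‖h t - p (φ n) t‖ₑ ^ (2 : ℝ)) (f := fun _ => 0)
      (fun _ => ENNReal.ofReal (2 * M) ^ (2 : ℝ)) (fun n =>
        ((hh.mono_ac hac).sub (hp _).aestronglyMeasurable).enorm.pow_const _) (fun n => ?_) ?_ ?_
    · simpa using this
    · filter_upwards [hac.ae_le hM] with t ht
      refine ENNReal.rpow_le_rpow ?_ (by norm_num)
      rw [← ofReal_norm]
      refine ENNReal.ofReal_le_ofReal ((norm_sub_le _ _).trans ?_)
      linarith [norm_cesaroMean_le hh hM hpos (φ n) t]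
    · simp only [lintegral_const]
      exact ENNReal.mul_ne_top
        (ENNReal.rpow_ne_top_of_nonneg (by norm_num) ENNReal.ofReal_ne_top) (measure_ne_top _ _)
    · filter_upwards [hlim] with t ht
      have h1 : Tendsto (fun n => h t - p (φ n) t) atTop (𝓝 0) := by
        simpa using (tendsto_const_nhds (x := h t)).sub ht
      have h2 := (ENNReal.continuous_rpow_const (y := 2)).tendsto _ |>.comp h1.enorm
      simpa [Function.comp_def] using h2
  have hL2 : Tendsto (fun n => eLpNorm (fun t => h t - p (φ n) t) 2 ν) atTop (𝓝 0) := by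
    simp_rw [eLpNorm_eq_lintegral_rpow_enorm_toReal two_ne_zero ENNReal.ofNat_ne_top]
    have h2 := (ENNReal.continuous_rpow_const (y := 1 / 2)).tendsto _ |>.comp hL
    simpa [Function.comp_def] using h2
  obtain ⟨n, hn⟩ := (hL2.eventually_lt_const hε).exists
  exact ⟨cesaroMean h (φ n), hn⟩

/-! ### The functional -/

section Transfer

variable {a : ℕ → ℂ} (ha : Summable fun k => ‖a k‖)
include ha

lemma continuous_transfer : Continuous (transfer a) :=
  continuous_tsum (fun k => (continuous_const.mul (continuous_expo _))) ha fun k t => by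
    rw [norm_mul, norm_expo, mul_one]

lemma norm_transfer_le (t : ℝ) : ‖transfer a t‖ ≤ ∑' k, ‖a k‖ :=
  tsum_of_norm_bounded ha.hasSum fun k => by rw [norm_mul, norm_expo, mul_one]

lemma integral_transfer_mul {F : ℝ → ℂ} (hF : Integrable F arc) :
    ∑' m : ℕ, (∫ t, expo (-(m : ℤ)) t * F t ∂arc) * a m = ∫ t, transfer a t * F t ∂arc := by
  have hi (m : ℕ) : Integrable (fun t => a m * expo (-(m : ℤ)) t * F t) arc := by
    have := (integrable_mul_expo hF (-(m : ℤ))).const_mul (a m)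
    refine this.congr (Eventually.of_forall fun t => ?_)
    ring
  have hn (m : ℕ) : ∫ t, ‖a m * expo (-(m : ℤ)) t * F t‖ ∂arc = ‖a m‖ * ∫ t, ‖F t‖ ∂arc := by
    simp_rw [norm_mul, norm_expo, mul_one]
    exact integral_const_mul _ _
  have h := (hasSum_integral_of_summable_integral_norm hi
    (by simp_rw [hn]; exact ha.mul_right _)).tsum_eq
  simp_rw [transfer, ← tsum_mul_right]
  rw [← h]
  refine tsum_congr fun m => ?_
  rw [mul_comm, ← integral_const_mul]
  simp_rw [mul_assoc]

end Transfer

/-! ### A pair of densities that satisfies the minimality condition -/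

/-- A pair of spectral densities that satisfies the minimality condition. -/
structure IsMinimalPair (f g : ℝ → ℝ) : Prop where
  left : IsSpectralDensity f
  right : IsSpectralDensity g
  minimality : Minimality f g

/-- The exponential `e^{i(k+1)λ}` divided by the square root of `f + g`. -/
noncomputable def futureFun (f g : ℝ → ℝ) (k : ℕ) (t : ℝ) : ℂ :=
  expo ((k : ℤ) + 1) t / (√(f t + g t) : ℝ)

/-- The exponential `e^{imλ}` multiplied by the square root of `f + g`. -/
noncomputable def weightedExpo (f g : ℝ → ℝ) (m : ℤ) (t : ℝ) : ℂ :=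
  expo m t * (√(f t + g t) : ℝ)

/-- The function `A f` divided by the square root of `f + g`. -/
noncomputable def signalFun (a : ℕ → ℂ) (f g : ℝ → ℝ) (t : ℝ) : ℂ :=
  transfer a t * (f t : ℂ) / (√(f t + g t) : ℝ)

/-- The integrand `|A|² f g / (f + g)` of `⟨Q a, a⟩`. -/
noncomputable def noiseTerm (a : ℕ → ℂ) (f g : ℝ → ℝ) (t : ℝ) : ℝ :=
  ‖transfer a t‖ ^ 2 * (f t * g t / (f t + g t))

namespace IsMinimalPair

variable {f g : ℝ → ℝ} (hp : IsMinimalPair f g)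
include hp

lemma integrable_add : Integrable (fun t => f t + g t) arc := hp.left.1.add hp.right.1

/-- Since 1/0 = ∞ in the minimality integral, its finiteness excludes zeros of f + g on a set of
positive measure. -/
lemma ae_nonneg : ∀ᵐ t ∂arc, 0 ≤ f t ∧ 0 ≤ g t ∧ 0 < f t + g t := by
  have h : ∀ᵐ t ∂arc, (ENNReal.ofReal (f t + g t))⁻¹ < ⊤ :=
    ae_lt_top' hp.integrable_add.aemeasurable.ennreal_ofReal.inv hp.minimality.ne
  filter_upwards [hp.left.2, hp.right.2, h] with t h1 h2 h3
  refine ⟨h1, h2, ?_⟩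
  rwa [ENNReal.inv_lt_top, ENNReal.ofReal_pos] at h3

lemma aestronglyMeasurable_sqrt : AEStronglyMeasurable (fun t => √(f t + g t)) arc :=
  Real.continuous_sqrt.comp_aestronglyMeasurable hp.integrable_add.1

lemma aestronglyMeasurable_sqrt_ofReal :
    AEStronglyMeasurable (fun t => ((√(f t + g t) : ℝ) : ℂ)) arc :=
  Complex.continuous_ofReal.comp_aestronglyMeasurable hp.aestronglyMeasurable_sqrt

lemma integrable_inv : Integrable (fun t => 1 / (f t + g t)) arc := by
  have hm : AEMeasurable (fun t => 1 / (f t + g t)) arc :=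
    aemeasurable_const.div hp.integrable_add.aemeasurable
  refine ⟨hm.aestronglyMeasurable, ?_⟩
  unfold HasFiniteIntegral
  refine lt_of_eq_of_lt (lintegral_congr_ae ?_) hp.minimality
  filter_upwards [hp.ae_nonneg] with t ht
  rw [← ofReal_norm, Real.norm_of_nonneg (by have := ht.2.2; positivity), one_div,
    ENNReal.ofReal_inv_of_pos ht.2.2]

lemma integrable_of_abs_le {q b : ℝ → ℝ} (hq : AEMeasurable q arc) (hb : Integrable b arc)
    (h : ∀ t, 0 ≤ f t → 0 ≤ g t → 0 < f t + g t → |q t| ≤ b t) : Integrable q arc := by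
  refine hb.mono' hq.aestronglyMeasurable ?_
  filter_upwards [hp.ae_nonneg] with t ht
  exact h t ht.1 ht.2.1 ht.2.2

lemma integrable_div : Integrable (fun t => f t / (f t + g t)) arc := by
  refine hp.integrable_of_abs_le (b := fun _ => 1)
    (hp.left.1.aemeasurable.div hp.integrable_add.aemeasurable) (integrable_const 1) ?_
  intro t h1 h2 h3
  rw [abs_of_nonneg (by positivity), div_le_one h3]
  linarith

lemma integrable_mul_div : Integrable (fun t => f t * g t / (f t + g t)) arc := by
  refine hp.integrable_of_abs_le (b := f)
    ((hp.left.1.aemeasurable.mul hp.right.1.aemeasurable).div hp.integrable_add.aemeasurable)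
    hp.left.1 ?_
  intro t h1 h2 h3
  rw [abs_of_nonneg (by positivity), div_le_iff₀ h3]
  nlinarith

lemma ae_sqrt : ∀ᵐ t ∂arc, (√(f t + g t) : ℂ) ≠ 0 ∧
    (√(f t + g t) : ℂ) * (√(f t + g t) : ℂ) = ((f t + g t : ℝ) : ℂ) := by
  filter_upwards [hp.ae_nonneg] with t ht
  refine ⟨by exact_mod_cast (Real.sqrt_pos.2 ht.2.2).ne', ?_⟩
  rw [← Complex.ofReal_mul, Real.mul_self_sqrt ht.2.2.le]

lemma memLp_futureFun (k : ℕ) : MemLp (futureFun f g k) 2 arc := by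
  have hm : AEStronglyMeasurable (futureFun f g k) arc :=
    ((continuous_expo _).aemeasurable.div
      hp.aestronglyMeasurable_sqrt_ofReal.aemeasurable).aestronglyMeasurable
  rw [memLp_two_iff_integrable_sq_norm hm]
  refine hp.integrable_inv.congr ?_
  filter_upwards [hp.ae_nonneg] with t ht
  simp only [futureFun]
  rw [norm_div, norm_expo, Complex.norm_real, div_pow, Real.norm_eq_abs, sq_abs,
    Real.sq_sqrt ht.2.2.le, one_pow]

lemma memLp_weightedExpo (m : ℤ) : MemLp (weightedExpo f g m) 2 arc := by
  have hm : AEStronglyMeasurable (weightedExpo f g m) arc :=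
    (continuous_expo _).aestronglyMeasurable.mul hp.aestronglyMeasurable_sqrt_ofReal
  rw [memLp_two_iff_integrable_sq_norm hm]
  refine hp.integrable_add.congr ?_
  filter_upwards [hp.ae_nonneg] with t ht
  simp only [weightedExpo]
  rw [norm_mul, norm_expo, Complex.norm_real, one_mul, Real.norm_eq_abs, sq_abs,
    Real.sq_sqrt ht.2.2.le]

/-- The vectors `e^{i(k+1)λ} / √(f + g)` of `L₂`. -/
noncomputable def future (k : ℕ) : Lp ℂ 2 arc := (hp.memLp_futureFun k).toLp _

/-- The vectors `e^{imλ} √(f + g)` of `L₂`. -/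
noncomputable def weighted (m : ℤ) : Lp ℂ 2 arc := (hp.memLp_weightedExpo m).toLp _

lemma matP_eq : matP f g = fun l k => inner ℂ (hp.future l) (hp.future k) := by
  ext l k
  unfold future
  rw [inner_toLp]
  refine integral_congr_ae ?_
  filter_upwards [hp.ae_sqrt] with t ⟨h1, h2⟩
  simp only [futureFun]
  rw [map_div₀, conj_expo, Complex.conj_ofReal, div_mul_div_comm, h2, ← expo_add]
  push_cast
  rw [mul_one_div]
  congr 2
  ring

/-- The two square roots cancel. This biorthogonality both reads off Fourier coefficients and
separates the past from the future. -/
lemma inner_weighted_future (m : ℤ) (k : ℕ) :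
    inner ℂ (hp.weighted m) (hp.future k) = if m = (k : ℤ) + 1 then 1 else 0 := by
  unfold weighted future
  rw [inner_toLp]
  have : ∫ t, conj (weightedExpo f g m t) * futureFun f g k t ∂arc =
      ∫ t, expo ((k : ℤ) + 1 - m) t ∂arc := by
    refine integral_congr_ae ?_
    filter_upwards [hp.ae_sqrt] with t ⟨h1, h2⟩
    simp only [futureFun, weightedExpo]
    rw [map_mul, conj_expo, Complex.conj_ofReal,
      show (k : ℤ) + 1 - m = -m + (k + 1) by ring, expo_add (-m)]
    field_simp
  rw [this, integral_expo]
  refine if_congr ?_ rfl rfl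
  omega

lemma inner_weighted_linearCombination (m : ℤ) (x : ℕ →₀ ℂ) :
    inner ℂ (hp.weighted m) (Finsupp.linearCombination ℂ hp.future x) =
      x.sum fun k z => z * if m = (k : ℤ) + 1 then 1 else 0 := by
  rw [Finsupp.linearCombination_apply, Finsupp.sum, Finsupp.sum, inner_sum]
  exact Finset.sum_congr rfl fun k _ => by rw [inner_smul_right, inner_weighted_future]

section Signal

variable {a : ℕ → ℂ} (ha : Summable fun k => ‖a k‖)
include ha

lemma memLp_signalFun : MemLp (signalFun a f g) 2 arc := by
  have hm : AEStronglyMeasurable (signalFun a f g) arc :=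
    (((continuous_transfer ha).aemeasurable.mul
      (Complex.continuous_ofReal.comp_aestronglyMeasurable hp.left.1.1).aemeasurable).div
      hp.aestronglyMeasurable_sqrt_ofReal.aemeasurable).aestronglyMeasurable
  rw [memLp_two_iff_integrable_sq_norm hm]
  refine (hp.left.1.const_mul ((∑' k, ‖a k‖) ^ 2)).mono' (hm.norm.pow 2) ?_
  filter_upwards [hp.ae_nonneg] with t ⟨h1, h2, h3⟩
  simp only [signalFun]
  rw [Real.norm_of_nonneg (sq_nonneg _), norm_div, norm_mul, Complex.norm_real, Complex.norm_real,
    Real.norm_of_nonneg h1, div_pow, Real.norm_eq_abs, sq_abs, Real.sq_sqrt h3.le, mul_pow,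
    mul_div_assoc]
  refine mul_le_mul (pow_le_pow_left₀ (norm_nonneg _) (norm_transfer_le ha t) 2) ?_
    (by positivity) (by positivity)
  rw [div_le_iff₀ h3]
  nlinarith

/-- The vector `A f / √(f + g)` of `L₂`. -/
noncomputable def signal : Lp ℂ 2 arc := (hp.memLp_signalFun ha).toLp _

lemma vecRa_eq : vecRa f g a = fun l => inner ℂ (hp.future l) (hp.signal ha) := by
  ext l
  unfold future signal vecRa
  rw [inner_toLp]
  have hF : Integrable (fun t => ((f t / (f t + g t) : ℝ) : ℂ) * expo (-((l : ℤ) + 1)) t) arc :=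
    integrable_mul_expo hp.integrable_div.ofReal _
  have hR (m : ℕ) : coefR f g (l + 1) m = ∫ t, expo (-(m : ℤ)) t *
      (((f t / (f t + g t) : ℝ) : ℂ) * expo (-((l : ℤ) + 1)) t) ∂arc := by
    unfold coefR
    congr 1
    ext t
    rw [show -((m : ℤ) + ((l + 1 : ℕ) : ℤ)) = -(m : ℤ) + -((l : ℤ) + 1) by push_cast; ring,
      expo_add]
    ring
  simp_rw [hR]
  rw [integral_transfer_mul ha hF]
  refine integral_congr_ae ?_
  filter_upwards [hp.ae_sqrt] with t ⟨h1, h2⟩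
  simp only [futureFun, signalFun]
  rw [map_div₀, conj_expo, Complex.conj_ofReal, div_mul_div_comm, h2]
  push_cast
  ring

lemma formQ_re_eq : (formQ f g a).re = ∫ t, noiseTerm a f g t ∂arc := by
  have hq : Integrable (fun t => ((f t * g t / (f t + g t) : ℝ) : ℂ)) arc :=
    hp.integrable_mul_div.ofReal
  have hA : Integrable (fun t => conj (transfer a t) * ((f t * g t / (f t + g t) : ℝ) : ℂ)) arc :=
    hq.bdd_mul (c := ∑' k, ‖a k‖)
      (Complex.continuous_conj.comp (continuous_transfer ha)).aestronglyMeasurable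
      (Eventually.of_forall fun t => by
        simpa using norm_transfer_le ha t)
  -- Conjugating the inner sum puts the outer one in the form of `integral_transfer_mul` again.
  have h1 (l : ℕ) : ∑' k : ℕ, matQ f g l k * a k =
      conj (∫ t, expo (-(l : ℤ)) t *
        (conj (transfer a t) * ((f t * g t / (f t + g t) : ℝ) : ℂ)) ∂arc) := by
    have := integral_transfer_mul ha (integrable_mul_expo hq (l : ℤ))
    rw [← integral_conj]
    have e : ∫ t, conj (expo (-(l : ℤ)) t *
        (conj (transfer a t) * ((f t * g t / (f t + g t) : ℝ) : ℂ))) ∂arc =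
        ∫ t, transfer a t * (((f t * g t / (f t + g t) : ℝ) : ℂ) * expo l t) ∂arc := by
      congr 1
      ext t
      simp only [map_mul, conj_expo, Complex.conj_conj, Complex.conj_ofReal, neg_neg]
      ring
    rw [e]
    refine Eq.trans (tsum_congr fun k => ?_) this
    unfold matQ
    congr 2
    ext t
    rw [sub_eq_add_neg, expo_add]
    ring
  unfold formQ
  simp_rw [h1, ← map_mul]
  rw [← Complex.conj_tsum, integral_transfer_mul ha hA, Complex.conj_re]
  have : ∫ t, transfer a t * (conj (transfer a t) * ((f t * g t / (f t + g t) : ℝ) : ℂ)) ∂arc =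
      ((∫ t, noiseTerm a f g t ∂arc : ℝ) : ℂ) := by
    rw [← integral_complex_ofReal]
    congr 1
    ext t
    rw [← mul_assoc, Complex.mul_conj, Complex.normSq_eq_norm_sq, noiseTerm, Complex.ofReal_mul]
  rw [this, Complex.ofReal_re]

/-- The objective is the squared norm of a projection plus the noise term. -/
theorem isObjectiveValue_iff (V : ℝ) : IsObjectiveValue a f g V ↔
    V = ‖proj hp.future (hp.signal ha)‖ ^ 2 + ∫ t, noiseTerm a f g t ∂arc := by
  unfold IsObjectiveValue
  rw [hp.matP_eq, hp.vecRa_eq ha, hp.formQ_re_eq ha]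
  simp_rw [isInverseForm_gram_iff]
  simp

end Signal

/-! ### The space `L₂⁰(f + g)` -/

/-- Multiplication by √(f + g) is the isometry that removes the weight. -/
lemma eLpNorm_withDensity (u : ℝ → ℂ) :
    eLpNorm u 2 (arc.withDensity fun t => ENNReal.ofReal (f t + g t)) =
      eLpNorm (fun t => u t * (√(f t + g t) : ℝ)) 2 arc := by
  rw [eLpNorm_eq_lintegral_rpow_enorm_toReal two_ne_zero ENNReal.ofNat_ne_top,
    eLpNorm_eq_lintegral_rpow_enorm_toReal two_ne_zero ENNReal.ofNat_ne_top,
    lintegral_withDensity_eq_lintegral_mul_non_measurable₀ _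
      hp.integrable_add.aemeasurable.ennreal_ofReal (by simp)]
  congr 1
  refine lintegral_congr_ae ?_
  filter_upwards [hp.ae_nonneg] with t ⟨_, _, h3⟩
  simp only [Pi.mul_apply, ENNReal.toReal_ofNat, ENNReal.rpow_two]
  rw [enorm_mul, mul_pow, mul_comm]
  congr 1
  rw [← ofReal_norm, Complex.norm_real, Real.norm_of_nonneg (Real.sqrt_nonneg _),
    ← ENNReal.ofReal_pow (Real.sqrt_nonneg _), Real.sq_sqrt h3.le]

lemma memLp_mul_sqrt {h : ℝ → ℂ} (hh : MemPastL2 (fun t => f t + g t) h) :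
    MemLp (fun t => h t * (√(f t + g t) : ℝ)) 2 arc := by
  have hac : arc ≪ arc.withDensity fun t => ENNReal.ofReal (f t + g t) :=
    withDensity_absolutelyContinuous' hp.integrable_add.aemeasurable.ennreal_ofReal (by
      filter_upwards [hp.ae_nonneg] with t ⟨_, _, h3⟩
      simpa using h3)
  refine ⟨(hh.1.1.mono_ac hac).mul hp.aestronglyMeasurable_sqrt_ofReal, ?_⟩
  rw [← hp.eLpNorm_withDensity]
  exact hh.1.2

/-- By biorthogonality, frequencies m ≤ 0 are orthogonal to frequencies l + 1 ≥ 1; this passes to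
the closed span. -/
lemma inner_future_eq_zero {h : ℝ → ℂ} (hh : MemPastL2 (fun t => f t + g t) h) (l : ℕ) :
    inner ℂ (hp.future l) ((hp.memLp_mul_sqrt hh).toLp _) = 0 := by
  have hmem : (hp.memLp_mul_sqrt hh).toLp _ ∈ closedSpan fun m : ℕ => hp.weighted (-(m : ℤ)) := by
    change _ ∈ closure (_ : Set _)
    rw [EMetric.mem_closure_iff]
    intro ε hε
    obtain ⟨p, hpε⟩ := hh.2 ε hε
    refine ⟨Finsupp.linearCombination ℂ (fun m : ℕ => hp.weighted (-(m : ℤ))) p, ?_, ?_⟩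
    · change _ ∈ Submodule.span ℂ _
      rw [← Finsupp.range_linearCombination]
      exact ⟨p, rfl⟩
    · refine lt_of_eq_of_lt ?_ hpε
      rw [hp.eLpNorm_withDensity, Lp.edist_def]
      refine eLpNorm_congr_ae ?_
      filter_upwards [(hp.memLp_mul_sqrt hh).coeFn_toLp, coeFn_linearCombination_toLp
        (fun m : ℕ => hp.memLp_weightedExpo (-(m : ℤ))) p] with t h1 h2
      rw [Pi.sub_apply, h1]
      refine Eq.trans (congrArg₂ _ rfl h2) ?_
      simp only [Finsupp.sum, weightedExpo, sub_mul, Finset.sum_mul, mul_assoc]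
  rw [inner_eq_zero_symm]
  refine inner_eq_zero_of_mem_closedSpan hmem fun m => ?_
  rw [inner_weighted_future, if_neg (by omega)]

lemma toLp_mul_sqrt_orthogonal {h : ℝ → ℂ} (hh : MemPastL2 (fun t => f t + g t) h)
    {D : Lp ℂ 2 arc} (hD : D ∈ closedSpan hp.future) :
    inner ℂ D ((hp.memLp_mul_sqrt hh).toLp _) = 0 :=
  inner_eq_zero_of_mem_closedSpan hD (hp.inner_future_eq_zero hh)

/-! ### The mean-square error -/

lemma specChar_mul_sqrt (a : ℕ → ℂ) (C : ℝ → ℂ) : ∀ᵐ t ∂arc, specChar a f g C t * (√(f t + g t) : ℝ) =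
    signalFun a f g t - C t / (√(f t + g t) : ℝ) := by
  filter_upwards [hp.ae_sqrt] with t ⟨h1, h2⟩
  rw [specChar, signalFun, ← h2]
  field_simp

section Error

variable {a : ℕ → ℂ} (ha : Summable fun k => ‖a k‖)
include ha

lemma integrable_noiseTerm : Integrable (noiseTerm a f g) arc :=
  hp.integrable_mul_div.bdd_mul (c := (∑' k, ‖a k‖) ^ 2)
    ((continuous_transfer ha).norm.pow 2).aestronglyMeasurable
    (Eventually.of_forall fun t => by
      rw [Real.norm_of_nonneg (by positivity)]
      exact pow_le_pow_left₀ (norm_nonneg _) (norm_transfer_le ha t) 2)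

/-- Completing the square pointwise: |A − h|²f + |h|²g = |h√w − Af/√w|² + |A|²fg/w with w = f + g.
-/
lemma mse_eq {h : ℝ → ℂ} (hh : MemLp (fun t => h t * (√(f t + g t) : ℝ)) 2 arc) :
    mse a h f g =
      ENNReal.ofReal (‖hh.toLp _ - hp.signal ha‖ ^ 2 + ∫ t, noiseTerm a f g t ∂arc) := by
  have hd : MemLp (fun t => h t * (√(f t + g t) : ℝ) - signalFun a f g t) 2 arc :=
    hh.sub (hp.memLp_signalFun ha)
  have e : hh.toLp _ - hp.signal ha = hd.toLp _ := (MemLp.toLp_sub hh (hp.memLp_signalFun ha)).symm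
  have hi := (memLp_two_iff_integrable_sq_norm hd.1).1 hd
  have hn := hp.integrable_noiseTerm ha
  have hin : Integrable (fun t => ‖h t * (√(f t + g t) : ℝ) - signalFun a f g t‖ ^ 2 +
    noiseTerm a f g t) arc := hi.add hn
  rw [e, norm_toLp_sq, ← integral_add hi hn, ofReal_integral_eq_lintegral_ofReal hin]
  · refine lintegral_congr_ae ?_
    filter_upwards [hp.ae_nonneg] with t ⟨h1, h2, h3⟩
    have en (z : ℂ) : ‖z‖ₑ ^ 2 = ENNReal.ofReal (‖z‖ ^ 2) := by
      rw [← ofReal_norm, ← ENNReal.ofReal_pow (norm_nonneg _)]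
    rw [en, en, ← ENNReal.ofReal_mul (by positivity), ← ENNReal.ofReal_mul (by positivity),
      ← ENNReal.ofReal_add (by positivity) (by positivity)]
    congr 1
    have hs : (√(f t + g t) : ℂ) ≠ 0 := by exact_mod_cast (Real.sqrt_pos.2 h3).ne'
    have hss : (√(f t + g t) : ℂ) * (√(f t + g t) : ℂ) = ((f t + g t : ℝ) : ℂ) := by
      rw [← Complex.ofReal_mul, Real.mul_self_sqrt h3.le]
    have e2 : h t * (√(f t + g t) : ℝ) - signalFun a f g t =
        (h t * ((f t + g t : ℝ) : ℂ) - transfer a t * (f t : ℂ)) / (√(f t + g t) : ℝ) := by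
      rw [signalFun, ← hss]
      field_simp
    rw [e2, norm_div, div_pow, Complex.norm_real, Real.norm_of_nonneg (Real.sqrt_nonneg _),
      Real.sq_sqrt h3.le, noiseTerm]
    simp only [Complex.sq_norm, Complex.normSq_apply, Complex.sub_re, Complex.sub_im,
      Complex.re_mul_ofReal, Complex.im_mul_ofReal]
    field_simp
    ring
  · filter_upwards [hp.ae_nonneg] with t ⟨h1, h2, h3⟩
    simp only [Pi.zero_apply, noiseTerm]
    positivity

/-- The vector h√w is orthogonal to D = proj G, so ⟨D, h√w − G⟩ = −‖D‖², and Cauchy–Schwarz gives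
‖D‖ ≤ ‖h√w − G‖. -/
lemma le_mse {h : ℝ → ℂ} (hh : MemPastL2 (fun t => f t + g t) h) :
    ENNReal.ofReal (‖proj hp.future (hp.signal ha)‖ ^ 2 + ∫ t, noiseTerm a f g t ∂arc) ≤
      mse a h f g := by
  rw [hp.mse_eq ha (hp.memLp_mul_sqrt hh)]
  refine ENNReal.ofReal_le_ofReal (add_le_add_left ?_ _)
  set D := proj hp.future (hp.signal ha) with hD
  set v := (hp.memLp_mul_sqrt hh).toLp _ with hv
  have hDK : D ∈ closedSpan hp.future := proj_mem _ _
  have h1 : inner ℂ D (v - hp.signal ha) = -((‖D‖ ^ 2 : ℝ) : ℂ) := by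
    rw [inner_sub_right, hp.toLp_mul_sqrt_orthogonal hh hDK, ← inner_proj _ _ hDK,
      inner_self_eq_norm_sq_to_K]
    simp
  have h2 := norm_inner_le_norm (𝕜 := ℂ) D (v - hp.signal ha)
  rw [h1, norm_neg, Complex.norm_real, Real.norm_of_nonneg (by positivity)] at h2
  nlinarith [sq_nonneg (‖D‖ - ‖v - hp.signal ha‖)]

/-! ### The function `C` -/

variable {c : ℕ → ℂ} {C : ℝ → ℂ}

/-- Pairing the approximating combinations with the weighted exponentials shows that (proj G)√w has
coefficient c_k at frequency k + 1 and none at frequencies ≤ 0. It is integrable as a product of two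
L₂ functions, so uniqueness of Fourier coefficients in L₁ identifies it with C. -/
theorem seriesSum_ae (hc : IsInverseVector (matP f g) (vecRa f g a) c) (hC : IsSeriesSum c C) :
    ⇑(proj hp.future (hp.signal ha)) =ᵐ[arc] fun t => C t / (√(f t + g t) : ℝ) := by
  obtain ⟨x, hx, hxc⟩ := hc
  rw [hp.matP_eq, hp.vecRa_eq ha, approxInverse_gram_iff] at hx
  set D := proj hp.future (hp.signal ha) with hD
  have hDs : Integrable (fun t => D t * (√(f t + g t) : ℝ)) arc := by
    have h1 := hp.memLp_weightedExpo 0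
    have h2 := h1.integrable_mul (Lp.memLp D)
    refine h2.congr (Eventually.of_forall fun t => ?_)
    simp only [Pi.mul_apply, weightedExpo, expo_zero]
    ring
  have hcoef (m : ℤ) : ∫ t, D t * (√(f t + g t) : ℝ) * expo (-m) t ∂arc =
      inner ℂ (hp.weighted m) D := by
    conv_rhs => rw [← Lp.toLp_coeFn D (Lp.memLp D)]
    unfold weighted
    rw [inner_toLp]
    congr 1
    ext t
    rw [weightedExpo, map_mul, conj_expo, Complex.conj_ofReal]
    ring
  have hlim (m : ℤ) := (tendsto_const_nhds (x := hp.weighted m)).inner (𝕜 := ℂ) hx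
  simp_rw [inner_weighted_linearCombination] at hlim
  have hpos (k : ℕ) : inner ℂ (hp.weighted ((k : ℤ) + 1)) D = c k := by
    refine tendsto_nhds_unique ((hlim _).congr fun n => ?_) (hxc k)
    rw [Finsupp.sum, Finset.sum_eq_single k]
    · simp
    · intro j _ hj
      rw [if_neg (by omega), mul_zero]
    · intro hk
      simp [Finsupp.notMem_support_iff.1 hk]
  have hneg (k : ℕ) : inner ℂ (hp.weighted (-(k : ℤ))) D = 0 := by
    refine tendsto_nhds_unique ((hlim _).congr fun n => ?_) tendsto_const_nhds
    refine Finset.sum_eq_zero fun j _ => ?_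
    simp only
    rw [if_neg (by omega), mul_zero]
  have hz : ∀ᵐ t ∂arc, C t - D t * (√(f t + g t) : ℝ) = 0 := by
    refine ae_eq_zero_of_fourier (hC.1.sub hDs) fun m => ?_
    simp only [sub_mul]
    rw [integral_sub (integrable_mul_expo hC.1 m) (integrable_mul_expo hDs m), sub_eq_zero]
    have := hcoef (-m)
    rw [neg_neg] at this
    rw [this]
    rcases Int.lt_or_le m 0 with hm | hm
    · obtain ⟨k, rfl⟩ : ∃ k : ℕ, m = -((k : ℤ) + 1) := ⟨(-m - 1).toNat, by omega⟩
      rw [hC.2.1, neg_neg, hpos]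
    · lift m to ℕ using hm
      rw [hC.2.2, hneg]
  filter_upwards [hz, hp.ae_sqrt] with t h1 ⟨h2, _⟩
  rw [eq_div_iff h2, ← sub_eq_zero.1 h1]

lemma aestronglyMeasurable_specChar (hC : Integrable C arc) :
    AEStronglyMeasurable (specChar a f g C) arc :=
  ((((continuous_transfer ha).aemeasurable.mul
    (Complex.continuous_ofReal.comp_aestronglyMeasurable hp.left.1.1).aemeasurable).sub
    hC.aemeasurable).div (Complex.continuous_ofReal.comp_aestronglyMeasurable
      hp.integrable_add.1).aemeasurable).aestronglyMeasurable

/-! ### Optimality of the characteristic (Af − C)/(f + g). -/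

variable (hCae : ⇑(proj hp.future (hp.signal ha)) =ᵐ[arc]
  fun t => C t / (√(f t + g t) : ℝ))
include hCae

lemma specChar_mul_sqrt_ae : (fun t => specChar a f g C t * (√(f t + g t) : ℝ)) =ᵐ[arc]
    (hp.signal ha - proj hp.future (hp.signal ha) : Lp ℂ 2 arc) := by
  filter_upwards [hp.specChar_mul_sqrt a C, hCae, (hp.memLp_signalFun ha).coeFn_toLp,
    Lp.coeFn_sub (hp.signal ha) (proj hp.future (hp.signal ha))] with t h1 h2 h3 h4
  rw [h1, h4, Pi.sub_apply, h2, signal, h3]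

/-- The coefficient at frequency k + 1 is the inner product of u_k with G − proj G. -/
lemma specChar_no_future (k : ℕ) :
    ∫ t, specChar a f g C t * expo (-((k : ℤ) + 1)) t ∂arc = 0 := by
  have h := inner_sub_right (𝕜 := ℂ) (hp.future k) (hp.signal ha) (proj hp.future (hp.signal ha))
  rw [inner_proj _ _ (Submodule.le_topologicalClosure _ (Submodule.subset_span ⟨k, rfl⟩)),
    sub_self, ← Lp.toLp_coeFn (hp.signal ha - _) (Lp.memLp _)] at h
  unfold future at h
  rw [inner_toLp] at h
  rw [← h]
  refine integral_congr_ae ?_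
  filter_upwards [hp.specChar_mul_sqrt_ae ha hCae, hp.ae_sqrt] with t h1 ⟨h2, _⟩
  refine Eq.trans ?_ (congrArg₂ _ rfl h1)
  rw [futureFun, map_div₀, conj_expo, Complex.conj_ofReal]
  field_simp

lemma mse_specChar : mse a (specChar a f g C) f g =
    ENNReal.ofReal (‖proj hp.future (hp.signal ha)‖ ^ 2 + ∫ t, noiseTerm a f g t ∂arc) := by
  have hae := hp.specChar_mul_sqrt_ae ha hCae
  have hm : MemLp (fun t => specChar a f g C t * (√(f t + g t) : ℝ)) 2 arc :=
    (Lp.memLp _).ae_eq hae.symm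
  rw [hp.mse_eq ha hm]
  have : hm.toLp _ = hp.signal ha - proj hp.future (hp.signal ha) := by
    rw [← Lp.toLp_coeFn (hp.signal ha - proj hp.future (hp.signal ha)) (Lp.memLp _)]
    exact MemLp.toLp_congr _ _ hae
  rw [this, sub_sub_cancel_left, norm_neg]

theorem isOptimal_specChar (hC : Integrable C arc) {M : ℝ}
    (hM : ∀ᵐ t ∂arc, ‖specChar a f g C t‖ ≤ M) : IsOptimal a f g (specChar a f g C) := by
  refine ⟨memPastL2_of_bounded (hp.aestronglyMeasurable_specChar ha hC) hM
    (hp.specChar_no_future ha hCae) hp.integrable_add, fun h' hh' => ?_⟩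
  rw [hp.mse_specChar ha hCae]
  exact hp.le_mse ha hh'

end Error

end IsMinimalPair

/-! ### Increasing the noise -/

lemma IsMinimalPair.add_const {f g : ℝ → ℝ} (hp : IsMinimalPair f g) {ε : ℝ} (hε : 0 ≤ ε) :
    IsMinimalPair f fun t => g t + ε := by
  refine ⟨hp.left, ⟨hp.right.1.add (integrable_const ε), ?_⟩, ?_⟩
  · filter_upwards [hp.right.2] with t ht
    positivity
  · refine lt_of_le_of_lt (lintegral_mono fun t => ?_) hp.minimality
    gcongr
    linarith

section Increase

variable {a : ℕ → ℂ} (ha : Summable fun k => ‖a k‖) {f g : ℝ → ℝ}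
include ha

/-- The sum does not depend on g, so maximizing the objective means minimizing the distance from G
to the span of the future. -/
lemma IsMinimalPair.norm_signal_sq_add (hp : IsMinimalPair f g) :
    ‖hp.signal ha‖ ^ 2 + ∫ t, noiseTerm a f g t ∂arc = ∫ t, ‖transfer a t‖ ^ 2 * f t ∂arc := by
  have hm := hp.memLp_signalFun ha
  unfold IsMinimalPair.signal
  rw [norm_toLp_sq, ← integral_add ((memLp_two_iff_integrable_sq_norm hm.1).1 hm)
    (hp.integrable_noiseTerm ha)]
  refine integral_congr_ae ?_
  filter_upwards [hp.ae_nonneg] with t ⟨_, _, h3⟩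
  simp only [noiseTerm, signalFun]
  rw [norm_div, norm_mul, Complex.norm_real, Complex.norm_real, div_pow, Real.norm_eq_abs,
    Real.norm_eq_abs, sq_abs, Real.sq_sqrt h3.le, mul_pow, sq_abs]
  field_simp

/-- If the objective does not increase when white noise is added, then `A f = C`. -/
theorem IsMinimalPair.ae_eq_of_objective_le (hp : IsMinimalPair f g) {C : ℝ → ℂ}
    (hC : AEStronglyMeasurable C arc)
    (hCae : ⇑(proj hp.future (hp.signal ha)) =ᵐ[arc] fun t => C t / (√(f t + g t) : ℝ))
    {ε : ℝ} (hε : 0 < ε) (hp' : IsMinimalPair f fun t => g t + ε)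
    (hle : ‖proj hp'.future (hp'.signal ha)‖ ^ 2 + ∫ t, noiseTerm a f (fun t => g t + ε) t ∂arc ≤
      ‖proj hp.future (hp.signal ha)‖ ^ 2 + ∫ t, noiseTerm a f g t ∂arc) :
    ∀ᵐ t ∂arc, transfer a t * (f t : ℂ) = C t := by
  set D := proj hp.future (hp.signal ha) with hD
  have hwε : ∀ᵐ t ∂arc, 0 < f t + g t ∧ f t + g t < f t + (g t + ε) := by
    filter_upwards [hp.ae_nonneg] with t ⟨_, _, h3⟩
    exact ⟨h3, by linarith⟩
  -- division by the larger weight decreases the norm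
  have hnorm {F : ℝ → ℂ} : ∀ᵐ t ∂arc,
      ‖F t / (√(f t + (g t + ε)) : ℝ)‖ ≤ ‖F t / (√(f t + g t) : ℝ)‖ := by
    filter_upwards [hwε] with t ⟨h1, h2⟩
    rw [norm_div, norm_div, Complex.norm_real, Complex.norm_real,
      Real.norm_of_nonneg (Real.sqrt_nonneg _), Real.norm_of_nonneg (Real.sqrt_nonneg _)]
    exact div_le_div_of_nonneg_left (norm_nonneg _) (Real.sqrt_pos.2 h1) (Real.sqrt_le_sqrt h2.le)
  have hC0 : MemLp (fun t => C t / (√(f t + g t) : ℝ)) 2 arc := (Lp.memLp D).ae_eq hCae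
  have hC1 : MemLp (fun t => C t / (√(f t + (g t + ε)) : ℝ)) 2 arc := by
    refine MemLp.of_le hC0 ?_ hnorm
    exact (hC.aemeasurable.div
      hp'.aestronglyMeasurable_sqrt_ofReal.aemeasurable).aestronglyMeasurable
  -- The coefficients that approximate C/√w also approximate C over the larger root, because
  -- dividing by the larger root shrinks every error.
  have hmem : hC1.toLp _ ∈ closedSpan hp'.future := by
    obtain ⟨x, hx⟩ := (mem_closedSpan_iff hp.future D).1 (proj_mem _ _)
    refine (mem_closedSpan_iff _ _).2 ⟨x, ?_⟩
    rw [tendsto_iff_norm_sub_tendsto_zero] at hx ⊢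
    refine squeeze_zero (fun _ => norm_nonneg _) (fun n => ?_) hx
    refine Lp.norm_le_norm_of_ae_le ?_
    have h0 := coeFn_linearCombination_toLp hp.memLp_futureFun (x n)
    have h1 := coeFn_linearCombination_toLp hp'.memLp_futureFun (x n)
    filter_upwards [h0, h1, hCae, hC1.coeFn_toLp, Lp.coeFn_sub
      (Finsupp.linearCombination ℂ hp.future (x n)) D, Lp.coeFn_sub
      (Finsupp.linearCombination ℂ hp'.future (x n)) (hC1.toLp _),
      hnorm (F := fun t => ((x n).sum fun k z => z * expo ((k : ℤ) + 1) t) - C t)]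
      with t h0 h1 h2 h3 h4 h5 h6
    rw [h4, h5, Pi.sub_apply, Pi.sub_apply, h2, h3]
    have e0 : (Finsupp.linearCombination ℂ hp.future (x n) : Lp ℂ 2 arc) t =
        ((x n).sum fun k z => z * expo ((k : ℤ) + 1) t) / (√(f t + g t) : ℝ) := by
      refine Eq.trans h0 ?_
      simp only [Finsupp.sum, futureFun, Finset.sum_div, mul_div_assoc]
    have e1 : (Finsupp.linearCombination ℂ hp'.future (x n) : Lp ℂ 2 arc) t =
        ((x n).sum fun k z => z * expo ((k : ℤ) + 1) t) / (√(f t + (g t + ε)) : ℝ) := by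
      refine Eq.trans h1 ?_
      simp only [Finsupp.sum, futureFun, Finset.sum_div, mul_div_assoc]
    rw [e0, e1, ← sub_div, ← sub_div]
    exact h6
  have h1 := le_norm_proj_sq hp'.future (hp'.signal ha) hmem
  have h0 : ‖D‖ ^ 2 = ‖hp.signal ha‖ ^ 2 - ‖hp.signal ha - D‖ ^ 2 := by
    have := @norm_sub_sq ℂ _ _ _ _ (hp.signal ha) D
    rw [← inner_conj_symm, ← inner_proj _ _ (proj_mem hp.future _), ← hD,
      inner_self_eq_norm_sq_to_K, RCLike.conj_re] at this
    norm_cast at this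
    rw [this]
    ring
  -- In terms of F = Af − C this says ∫|F|²/w ≤ ∫|F|²/(w + ε), which is possible only if F = 0.
  have hmain : ‖hp.signal ha - D‖ ^ 2 ≤ ‖hp'.signal ha - hC1.toLp _‖ ^ 2 := by
    have e0 := hp.norm_signal_sq_add ha
    have e1 := hp'.norm_signal_sq_add ha
    linarith
  have hd0 : MemLp (fun t => (transfer a t * (f t : ℂ) - C t) / (√(f t + g t) : ℝ)) 2 arc := by
    simp_rw [sub_div]
    exact (hp.memLp_signalFun ha).sub hC0
  have hd1 : MemLp (fun t => (transfer a t * (f t : ℂ) - C t) / (√(f t + (g t + ε)) : ℝ)) 2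
      arc := by
    simp_rw [sub_div]
    exact (hp'.memLp_signalFun ha).sub hC1
  have e0 : hp.signal ha - D = hd0.toLp _ := by
    have : D = hC0.toLp _ := by
      rw [← Lp.toLp_coeFn D (Lp.memLp D)]
      exact MemLp.toLp_congr _ _ hCae
    rw [this, IsMinimalPair.signal, ← MemLp.toLp_sub]
    refine MemLp.toLp_congr _ _ (Eventually.of_forall fun t => ?_)
    simp [signalFun, sub_div]
  have e1 : hp'.signal ha - hC1.toLp _ = hd1.toLp _ := by
    rw [IsMinimalPair.signal, ← MemLp.toLp_sub]
    refine MemLp.toLp_congr _ _ (Eventually.of_forall fun t => ?_)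
    simp [signalFun, sub_div]
  rw [e0, e1, norm_toLp_sq, norm_toLp_sq] at hmain
  have hi0 := (memLp_two_iff_integrable_sq_norm hd0.1).1 hd0
  have hi1 := (memLp_two_iff_integrable_sq_norm hd1.1).1 hd1
  have hnn : 0 ≤ᵐ[arc] fun t =>
      ‖(transfer a t * (f t : ℂ) - C t) / (√(f t + g t) : ℝ)‖ ^ 2 -
      ‖(transfer a t * (f t : ℂ) - C t) / (√(f t + (g t + ε)) : ℝ)‖ ^ 2 := by
    filter_upwards [hnorm (F := fun t => transfer a t * (f t : ℂ) - C t)] with t ht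
    exact sub_nonneg.2 (pow_le_pow_left₀ (norm_nonneg _) ht 2)
  have hzero : ∫ t, (‖(transfer a t * (f t : ℂ) - C t) / (√(f t + g t) : ℝ)‖ ^ 2 -
      ‖(transfer a t * (f t : ℂ) - C t) / (√(f t + (g t + ε)) : ℝ)‖ ^ 2) ∂arc = 0 := by
    refine le_antisymm ?_ (integral_nonneg_of_ae hnn)
    rw [integral_sub hi0 hi1]
    linarith
  rw [integral_eq_zero_iff_of_nonneg_ae hnn (hi0.sub hi1)] at hzero
  filter_upwards [hzero, hwε] with t h2 ⟨h3, h4⟩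
  simp only [Pi.zero_apply] at h2
  rw [norm_div, norm_div, Complex.norm_real, Complex.norm_real, div_pow, div_pow,
    Real.norm_eq_abs, Real.norm_eq_abs, sq_abs, sq_abs, Real.sq_sqrt h3.le,
    Real.sq_sqrt (h3.trans h4).le] at h2
  by_contra hne
  have hpos : 0 < ‖transfer a t * (f t : ℂ) - C t‖ ^ 2 := by
    have := norm_pos_iff.2 (sub_ne_zero.2 hne)
    positivity
  have := div_lt_div_of_pos_left hpos h3 h4
  linarith

end Increase

/-! ### The saddle point and its consequences -/

/-- If `∫ |h|² g ≤ ∫ |h|² g₀`, then the error of `h` is at most that for `g₀`. -/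
lemma mse_le_mse {a : ℕ → ℂ} (ha : Summable fun k => ‖a k‖) {h : ℝ → ℂ}
    (hh : AEStronglyMeasurable h arc) {f g g₀ : ℝ → ℝ} (hf : Integrable f arc)
    (hle : ∫⁻ t, ‖h t‖ₑ ^ 2 * ENNReal.ofReal (g t) ∂arc ≤
      ∫⁻ t, ‖h t‖ₑ ^ 2 * ENNReal.ofReal (g₀ t) ∂arc) :
    mse a h f g ≤ mse a h f g₀ := by
  have hm : AEMeasurable (fun t => ‖transfer a t - h t‖ₑ ^ 2 * ENNReal.ofReal (f t)) arc :=
    (((continuous_transfer ha).aestronglyMeasurable.sub hh).enorm.pow_const 2).mul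
      hf.aemeasurable.ennreal_ofReal
  unfold mse
  rw [lintegral_add_left' hm, lintegral_add_left' hm]
  exact add_le_add_right hle _

/-- A function of norm at most `α`, with equality where `g₀` is positive, gives its largest noise
error at `g₀` if `g₀` has the full power. -/
lemma lintegral_le_of_full_power {h : ℝ → ℂ} {α P₂ : ℝ} {g g₀ : ℝ → ℝ}
    (hg : g ∈ powerClass P₂) (hg₀ : IsSpectralDensity g₀) (hP : P₂ ≤ ∫ t, g₀ t ∂arc)
    (hle : ∀ᵐ t ∂arc, ‖h t‖ ≤ α) (heq : ∀ᵐ t ∂arc, 0 < g₀ t → ‖h t‖ = α) :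
    ∫⁻ t, ‖h t‖ₑ ^ 2 * ENNReal.ofReal (g t) ∂arc ≤
      ∫⁻ t, ‖h t‖ₑ ^ 2 * ENNReal.ofReal (g₀ t) ∂arc := by
  calc ∫⁻ t, ‖h t‖ₑ ^ 2 * ENNReal.ofReal (g t) ∂arc
      ≤ ∫⁻ t, ENNReal.ofReal α ^ 2 * ENNReal.ofReal (g t) ∂arc := by
        refine lintegral_mono_ae ?_
        filter_upwards [hle] with t ht
        gcongr
        rw [← ofReal_norm]
        exact ENNReal.ofReal_le_ofReal ht
    _ = ENNReal.ofReal α ^ 2 * ENNReal.ofReal (∫ t, g t ∂arc) := by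
        rw [lintegral_const_mul'' _ hg.1.1.aemeasurable.ennreal_ofReal,
          ofReal_integral_eq_lintegral_ofReal hg.1.1 hg.1.2]
    _ ≤ ENNReal.ofReal α ^ 2 * ENNReal.ofReal (∫ t, g₀ t ∂arc) := by
        exact mul_le_mul_right (ENNReal.ofReal_le_ofReal (hg.2.trans hP)) _
    _ = ∫⁻ t, ENNReal.ofReal α ^ 2 * ENNReal.ofReal (g₀ t) ∂arc := by
        rw [lintegral_const_mul'' _ hg₀.1.aemeasurable.ennreal_ofReal,
          ofReal_integral_eq_lintegral_ofReal hg₀.1 hg₀.2]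
    _ = ∫⁻ t, ‖h t‖ₑ ^ 2 * ENNReal.ofReal (g₀ t) ∂arc := by
        refine lintegral_congr_ae ?_
        filter_upwards [heq] with t ht
        rcases le_or_gt (g₀ t) 0 with h0 | h0
        · simp [ENNReal.ofReal_of_nonpos h0]
        · rw [← ofReal_norm, ht h0]

/-- An optimal characteristic in `H_D` whose error over `D` is largest at the pair it is optimal
for: that pair is least favorable and the characteristic is minimax-robust. -/
theorem leastFavorable_and_minimaxRobust {a : ℕ → ℂ} {D : Set ((ℝ → ℝ) × (ℝ → ℝ))}
    {f₀ g₀ : ℝ → ℝ} {h₀ : ℝ → ℂ} (hD : (f₀, g₀) ∈ D) (hopt : IsOptimal a f₀ g₀ h₀)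
    (hcommon : h₀ ∈ commonPast D) (hsaddle : ∀ q ∈ D, mse a h₀ q.1 q.2 ≤ mse a h₀ f₀ g₀) :
    IsLeastFavorable a D f₀ g₀ ∧ IsMinimaxRobust a D h₀ := by
  refine ⟨⟨hD, h₀, hopt, fun q hq h hh => (hh.2 h₀ (hcommon q hq)).trans (hsaddle q hq)⟩,
    hcommon, ⟨h₀, hcommon, rfl⟩, ?_⟩
  rintro _ ⟨h, hh, rfl⟩
  have h1 : ⨆ q ∈ D, mse a h₀ q.1 q.2 ≤ mse a h₀ f₀ g₀ := iSup₂_le hsaddle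
  have h2 : mse a h₀ f₀ g₀ ≤ mse a h f₀ g₀ := hopt.2 h (hh (f₀, g₀) hD)
  have h3 : mse a h f₀ g₀ ≤ ⨆ q ∈ D, mse a h q.1 q.2 := le_iSup₂_of_le (f₀, g₀) hD le_rfl
  exact h1.trans (h2.trans h3)

end Filtering

/-! ### The minimax theorem. -/

theorem mainTheorem7
    (a : ℕ → ℂ) (ha : Summable fun k => ‖a k‖)
    (ha' : Summable fun k : ℕ => ((k : ℝ) + 1) * ‖a k‖ ^ 2)
    (f g₀ : ℝ → ℝ) (P₂ : ℝ)
    (hf : Filtering.IsSpectralDensity f) (hg₀ : g₀ ∈ Filtering.powerClass P₂)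
    (hmin : Filtering.Minimality f g₀)
    (c : ℕ → ℂ)
    (hc : Filtering.IsInverseVector (Filtering.matP f g₀) (Filtering.vecRa f g₀ a) c)
    (C : ℝ → ℂ) (hC : Filtering.IsSeriesSum c C)
    (hbdd : ∃ M : ℝ, ∀ᵐ t ∂Filtering.arc,
      ‖Filtering.transfer a t * (f t : ℂ) - C t‖ / (f t + g₀ t) ≤ M)
    (α₂ : ℝ) (hα₂ : 0 < α₂)
    (hform : ∀ᵐ t ∂Filtering.arc,
      g₀ t = max 0 (‖Filtering.transfer a t * (f t : ℂ) - C t‖ / α₂ - f t))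
    (hopt : Filtering.SolvesOptimization a ({f} ×ˢ Filtering.powerClass P₂) f g₀) :
    Filtering.IsLeastFavorable a ({f} ×ˢ Filtering.powerClass P₂) f g₀ ∧
    Filtering.IsOptimal a f g₀ (Filtering.specChar a f g₀ C) ∧
    Filtering.IsMinimaxRobust a ({f} ×ˢ Filtering.powerClass P₂)
      (Filtering.specChar a f g₀ C) := by
  have hp : Filtering.IsMinimalPair f g₀ := ⟨hf, hg₀.1, hmin⟩
  have hCae := hp.seriesSum_ae ha hc hC
  have hmeas := hp.aestronglyMeasurable_specChar ha hC.1
  have hnorm : ∀ᵐ t ∂Filtering.arc, ‖Filtering.specChar a f g₀ C t‖ =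
      ‖Filtering.transfer a t * (f t : ℂ) - C t‖ / (f t + g₀ t) := by
    filter_upwards [hp.ae_nonneg] with t ⟨_, _, h3⟩
    rw [Filtering.specChar, norm_div, Complex.norm_real, Real.norm_of_nonneg h3.le]
  obtain ⟨M, hM⟩ := hbdd
  have hbound : ∀ᵐ t ∂Filtering.arc, ‖Filtering.specChar a f g₀ C t‖ ≤ M := by
    filter_upwards [hM, hnorm] with t h1 h2
    rwa [h2]
  have hoptimal := hp.isOptimal_specChar ha hCae hC.1 hbound
  have hsaddle : ∀ g ∈ Filtering.powerClass P₂,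
      ∫⁻ t, ‖Filtering.specChar a f g₀ C t‖ₑ ^ 2 * ENNReal.ofReal (g t) ∂Filtering.arc ≤
        ∫⁻ t, ‖Filtering.specChar a f g₀ C t‖ₑ ^ 2 * ENNReal.ofReal (g₀ t) ∂Filtering.arc := by
    intro g hg
    -- With full power the formula for g⁰ decides; with unused power, maximality of the objective
    -- does.
    rcases le_or_gt P₂ (∫ t, g₀ t ∂Filtering.arc) with hP | hP
    · refine Filtering.lintegral_le_of_full_power (α := α₂) hg hg₀.1 hP ?_ ?_
      · filter_upwards [hp.ae_nonneg, hform, hnorm] with t ⟨_, _, h3⟩ h4 h5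
        rw [h5, div_le_iff₀ h3]
        have := (le_max_right 0 _).trans_eq h4.symm
        rw [sub_le_iff_le_add, div_le_iff₀ hα₂] at this
        linarith
      · filter_upwards [hp.ae_nonneg, hform, hnorm] with t ⟨_, _, h3⟩ h4 h5 h6
        have h7 : g₀ t = ‖Filtering.transfer a t * (f t : ℂ) - C t‖ / α₂ - f t := by
          rcases max_choice 0 (‖Filtering.transfer a t * (f t : ℂ) - C t‖ / α₂ - f t) with h | h
          · rw [h] at h4
            exact absurd h4 h6.ne'
          · rw [h4, h]
        rw [h5, div_eq_iff h3.ne']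
        field_simp at h7
        linarith
    -- The arc has mass one, so adding the unused power as a constant brings the noise to power
    -- exactly P₂.
    · have hε : 0 < P₂ - ∫ t, g₀ t ∂Filtering.arc := sub_pos.2 hP
      have hp' := hp.add_const hε.le
      obtain ⟨-, V₀, hV₀, hmax⟩ := hopt
      have hmem : (fun t => g₀ t + (P₂ - ∫ t, g₀ t ∂Filtering.arc)) ∈
          Filtering.powerClass P₂ := by
        refine ⟨hp'.right, ?_⟩
        rw [integral_add hg₀.1.1 (integrable_const _)]
        simp
      have hle := hmax (f, _) ⟨rfl, hmem⟩ hp'.minimality _ ((hp'.isObjectiveValue_iff ha _).2 rfl)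
      rw [(hp.isObjectiveValue_iff ha _).1 hV₀] at hle
      have hzero := hp.ae_eq_of_objective_le ha hC.1.1 hCae hε hp' hle
      refine lintegral_mono_ae ?_
      filter_upwards [hzero] with t ht
      simp [Filtering.specChar, ht]
  have hcommon : Filtering.specChar a f g₀ C ∈
      Filtering.commonPast ({f} ×ˢ Filtering.powerClass P₂) := by
    rintro ⟨f', g⟩ ⟨hf', hg⟩
    obtain rfl : f' = f := hf'
    exact Filtering.memPastL2_of_bounded hmeas hbound (hp.specChar_no_future ha hCae)
      (hf.1.add hg.1.1)
  have h := Filtering.leastFavorable_and_minimaxRobust hopt.1 hoptimal hcommon (by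
    rintro ⟨f', g⟩ ⟨hf', hg⟩
    obtain rfl : f' = f := hf'
    exact Filtering.mse_le_mse ha hmeas hf.1 (hsaddle g hg))
  exact ⟨h.1, hoptimal, h.2⟩
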